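/- Conventions (positive logic). "Formula" means positive existential formula (built from atomic formulas, $\top,\bot$ with $\wedge,\vee,\exists$); a theory $T$ is a set of h-inductive sentences $\forall x(\varphi(x)\to\psi(x))$ with $\varphi,\psi$ positive; a model $M$ of $T$ is e.c. (existentially closed) if every homomorphism from $M$ to a model of $T$ reflects positive formulas. $M$ is $\mu$-saturated if every finitely satisfiable set of formulas in fewer than $\mu$ variables and over fewer than $\mu$ parameters from $M$ is realised in $M$. A type over a set is a maximal consistent set of formulas over it; a partial type is any set of formulas. We work in a monster model $\mathfrak M$ of $T$: an e.c. model that is $\kappa$-saturated and strongly $\kappa$-homogeneous (tuples of length $<\kappa$ with the same type are conjugate under automorphisms) for a large $\kappa$, meaning that $\kappa>|T|$ and $\beth_{(2^\mu)^+}<\kappa$ for all $\mu<\kappa$; "small" means of cardinality $<\kappa$. Here $|T|$ is the number of formulas of the language, i.e. $\aleph_0$ plus the number of its symbols, and $\lambda_T=\beth_{(2^{|T|})^+}$. For (possibly infinite) tuples $a,a'$, write $\mathrm d_C(a,a')\le n$ if there are $a=a_0,a_1,\dots,a_n=a'$ such that $a_i,a_{i+1}$ lie on a $C$-indiscernible sequence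 $(s_j)_{j<\omega}$ for each $i<n$, and $a\equiv^{\mathrm{Ls}}_C a'$ if $\mathrm d_C(a,a')\le n$ for some $n<\omega$. $T$ is thick if there is a partial type $\Theta((x_i)_{i<\omega})$ over $\emptyset$, for each length of the tuples $x_i$, whose realisations in $\mathfrak M$ are exactly the indiscernible sequences. A type $q(x)$ over $N\supseteq C$ is $C$-Ls-invariant if for $\alpha\models q$ and all (possibly infinite) tuples $b,b'$ in $N$ with $b\equiv^{\mathrm{Ls}}_C b'$ we have $\alpha b\equiv^{\mathrm{Ls}}_C\alpha b'$. Proposition (Being Ls-invariant is type-definable). Let $T$ be a thick theory, let $N\subseteq\mathfrak M$ be a small e.c. model of $T$, let $C\subseteq N$, suppose that $N$ is $(2^{|C|+\lambda_T})^+$-saturated, and let $x$ be a small tuple of variables. (The case in which $N$ is itself a monster model is included, by taking for $\mathfrak M$ a bigger monster in which $N$ is small.) Let $\Sigma(x)$ be $$\bigcup\{\,\mathrm d_C(xb,xb')\le 2 \;:\; b,b'\in N \text{ finite tuples with } \mathrm d_C(b,b')\le 1\,\},$$ where $\mathrm d_C(xb,xb')\le2$ stands for the set of all formulas $\varphi(xb,xb')$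 such that $\varphi(y,y')$ is a formula over $C$ that holds of every pair of tuples $y,y'$ in $\mathfrak M$ (of the length of $xb$) with $\mathrm d_C(y,y')\le 2$. Then $\Sigma(x)$ is a partial type over $N$; a tuple $\alpha$ in $\mathfrak M$ realises $\Sigma$ if and only if $\mathrm d_C(\alpha b,\alpha b')\le2$ for all finite tuples $b,b'\in N$ with $\mathrm d_C(b,b')\le1$; and for every type $q(x)$ over $N$, the following are equivalent: $q$ is $C$-Ls-invariant; every realisation $\alpha$ of $q$ in $\mathfrak M$ satisfies $\Sigma$; some realisation $\alpha$ of $q$ in $\mathfrak M$ satisfies $\Sigma$. -/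

import Mathlib

open FirstOrder FirstOrder.Language Cardinal

universe u w

namespace PositiveLogic

/-- Positive (existential) formulas: built from `⊥`, `⊤` and atomic formulas using `∧`, `∨`, `∃`. -/
inductive IsPositive {L : FirstOrder.Language.{u, u}} {X : Type w} :
    ∀ {n : ℕ}, L.BoundedFormula X n → Prop
  | falsum {n : ℕ} : IsPositive (⊥ : L.BoundedFormula X n)
  | verum {n : ℕ} : IsPositive (⊤ : L.BoundedFormula X n)
  | equal {n : ℕ} (t₁ t₂ : L.Term (X ⊕ Fin n)) : IsPositive (BoundedFormula.equal t₁ t₂)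
  | rel {n l : ℕ} (R : L.Relations l) (ts : Fin l → L.Term (X ⊕ Fin n)) :
      IsPositive (BoundedFormula.rel R ts)
  | inf {n : ℕ} {φ ψ : L.BoundedFormula X n} :
      IsPositive φ → IsPositive ψ → IsPositive (φ ⊓ ψ)
  | sup {n : ℕ} {φ ψ : L.BoundedFormula X n} :
      IsPositive φ → IsPositive ψ → IsPositive (φ ⊔ ψ)
  | ex {n : ℕ} {φ : L.BoundedFormula X (n + 1)} : IsPositive φ → IsPositive φ.ex

/-- An h-inductive (positive) theory: all axioms have the form `∀ x, (φ(x) → ψ(x))` with `φ`, `ψ`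
positive. -/
def IsHInductive {L : FirstOrder.Language.{u, u}} (T : L.Theory) : Prop :=
  ∀ σ ∈ T, ∃ (n : ℕ) (φ ψ : L.BoundedFormula Empty n),
    IsPositive φ ∧ IsPositive ψ ∧ σ = (φ.imp ψ).alls

/-- An immersion: a homomorphism that reflects positive formulas. -/
def IsImmersion {L : FirstOrder.Language.{u, u}} {M K : Type u} [L.Structure M] [L.Structure K]
    (f : M →[L] K) : Prop :=
  ∀ (n : ℕ) (φ : L.Formula (Fin n)), IsPositive φ →
    ∀ a : Fin n → M, φ.Realize (f ∘ a) → φ.Realize a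

/-- `M` is an existentially closed model of `T`: a model all of whose homomorphisms to models of
`T` are immersions. -/
def IsEC {L : FirstOrder.Language.{u, u}} (T : L.Theory) (M : Type u) [L.Structure M] : Prop :=
  M ⊨ T ∧ ∀ (K : Type u) [L.Structure K], K ⊨ T → ∀ f : M →[L] K, IsImmersion f

section Formulas

variable {L : FirstOrder.Language.{u, u}} {M : Type u} [L.Structure M]

/-- A formula over the parameter set `A` in the variables `X` is an `L`-formula in the variables
`A ⊕ X`; the tuple `a` satisfies a set `Γ` of such formulas when each one holds with the elements
of `A` interpreted as themselves. -/
def Realizes {A : Set M} {X : Type w} (a : X → M) (Γ : Set (L.Formula (A ⊕ X))) : Prop :=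
  ∀ φ ∈ Γ, φ.Realize (Sum.elim (fun c : A => (c : M)) a)

/-- Every finite subset of `Γ` is satisfied by some tuple in `M`. -/
def FinitelySatisfiable {A : Set M} {X : Type w} (Γ : Set (L.Formula (A ⊕ X))) : Prop :=
  ∀ Δ : Finset (L.Formula (A ⊕ X)), (Δ : Set (L.Formula (A ⊕ X))) ⊆ Γ →
    ∃ a : X → M, Realizes a (Δ : Set (L.Formula (A ⊕ X)))

/-- A type over `A` (in the sense of the ambient model `M`): a maximal consistent set of positive
formulas over `A`. -/
def IsType {A : Set M} {X : Type w} (q : Set (L.Formula (A ⊕ X))) : Prop :=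
  Maximal (fun p : Set (L.Formula (A ⊕ X)) => (∀ φ ∈ p, IsPositive φ) ∧ FinitelySatisfiable p) q

variable (L)

/-- `a ≡_A b`: the tuples satisfy the same positive formulas over `A`. -/
def SameType (A : Set M) {X : Type w} (a b : X → M) : Prop :=
  ∀ φ : L.Formula (A ⊕ X), IsPositive φ →
    (φ.Realize (Sum.elim (fun c : A => (c : M)) a) ↔
      φ.Realize (Sum.elim (fun c : A => (c : M)) b))

/-- The sequence `(s i)_{i < ω}` of `X`-tuples is `A`-indiscernible. -/
def Indiscernible (A : Set M) {X : Type w} (s : ℕ → X → M) : Prop :=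
  ∀ (n : ℕ) (i j : Fin n → ℕ), StrictMono i → StrictMono j →
    SameType L A (fun p : Fin n × X => s (i p.1) p.2) (fun p : Fin n × X => s (j p.1) p.2)

/-- `d_C(a, b) ≤ n`: there are `a = c 0, …, c n = b` such that any two consecutive ones lie on a
`C`-indiscernible sequence. -/
def DistLE (C : Set M) (n : ℕ) {X : Type w} (a b : X → M) : Prop :=
  ∃ c : ℕ → X → M, c 0 = a ∧ c n = b ∧
    ∀ m < n, ∃ (s : ℕ → X → M) (i j : ℕ), Indiscernible L C s ∧ s i = c m ∧ s j = c (m + 1)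

/-- Equality of Lascar strong types over `C`: `d_C(a, b)` is finite. -/
def LsEquiv (C : Set M) {X : Type w} (a b : X → M) : Prop :=
  ∃ n : ℕ, DistLE L C n a b

variable (M)

/-- Positive `κ`-saturation: finitely satisfiable sets of positive formulas in fewer than `κ`
variables over fewer than `κ` parameters are satisfied. -/
def IsSaturated (κ : Cardinal.{u}) : Prop :=
  ∀ (A : Set M), #A < κ → ∀ X : Type u, #X < κ → ∀ Γ : Set (L.Formula (A ⊕ X)),
    (∀ φ ∈ Γ, IsPositive φ) → FinitelySatisfiable Γ → ∃ a : X → M, Realizes a Γ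

/-- Thickness, read in the monster model `M`: for tuples of any length, being an indiscernible
sequence is defined by a partial type `Θ((x_i)_{i < ω})` without parameters. -/
def IsThick : Prop :=
  ∀ X : Type u, ∃ Θ : Set (L.Formula (ℕ × X)), (∀ φ ∈ Θ, IsPositive φ) ∧
    ∀ s : ℕ → X → M,
      (∀ φ ∈ Θ, φ.Realize (fun p : ℕ × X => s p.1 p.2)) ↔ Indiscernible L (∅ : Set M) s

end Formulas

/-- `|T|`, the number of formulas of the language. -/
noncomputable def theoryCard (L : FirstOrder.Language.{u, u}) : Cardinal.{u} := max ℵ₀ L.card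

/-- `λ_T = ℶ_{(2^{|T|})⁺}`. -/
noncomputable def lambdaT (L : FirstOrder.Language.{u, u}) : Cardinal.{u} :=
  Cardinal.beth (Order.succ ((2 : Cardinal.{u}) ^ theoryCard L)).ord

/-- `M` is a monster model of `T` in which "small" means "of cardinality less than `κ`": an
existentially closed model that is `κ`-saturated and strongly `κ`-homogeneous, where `κ` is large:
it exceeds `|T|` and is closed under `μ ↦ ℶ_{(2^μ)⁺}`. -/
structure IsMonster {L : FirstOrder.Language.{u, u}} (T : L.Theory) (κ : Cardinal.{u}) (M : Type u)
    [L.Structure M] : Prop where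
  theory_small : theoryCard L < κ
  beth_small : ∀ μ < κ, Cardinal.beth (Order.succ ((2 : Cardinal.{u}) ^ μ)).ord < κ
  ec : IsEC T M
  saturated : IsSaturated L M κ
  homogeneous : ∀ X : Type u, #X < κ → ∀ a b : X → M, SameType L (∅ : Set M) a b →
    ∃ f : M ≃[L] M, ∀ x, f (a x) = b x

section Invariance

variable {L : FirstOrder.Language.{u, u}} {M : Type u} [L.Structure M]

/-- The type `q` over `N` is `C`-Ls-invariant: if `α` realises `q` and `b`, `b'` are (possibly
infinite) tuples in `N` with `b ≡^Ls_C b'`, then `αb ≡^Ls_C αb'`. -/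
def LsInvariant (C : Set M) {N : Set M} {X : Type u} (q : Set (L.Formula (N ⊕ X))) : Prop :=
  ∀ α : X → M, Realizes α q → ∀ (J : Type u) (b b' : J → M),
    (∀ j, b j ∈ N) → (∀ j, b' j ∈ N) → LsEquiv L C b b' →
      LsEquiv L C (Sum.elim α b) (Sum.elim α b')

variable (L)

/-- The partial type `d_C(y, y') ≤ n` over `C`: all positive formulas over `C` that hold at every
pair of tuples at distance at most `n`. -/
def distType (C : Set M) (n : ℕ) (Y : Type w) : Set (L.Formula (C ⊕ (Y ⊕ Y))) :=
  {φ | IsPositive φ ∧ ∀ a b : Y → M, DistLE L C n a b →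
    φ.Realize (Sum.elim (fun c : C => (c : M)) (Sum.elim a b))}

/-- The substitution `(y, y') := (xb, xb')` for finite tuples `b`, `b'` in `N ⊇ C`. -/
def substVars {C N : Set M} (hC : C ⊆ N) (X : Type u) {k : ℕ} (b b' : Fin k → N) :
    C ⊕ ((X ⊕ Fin k) ⊕ (X ⊕ Fin k)) → N ⊕ X :=
  Sum.elim (fun c => Sum.inl ⟨c, hC c.2⟩)
    (Sum.elim (Sum.elim Sum.inr (fun i => Sum.inl (b i)))
      (Sum.elim Sum.inr (fun i => Sum.inl (b' i))))

/-- `Σ(x) = ⋃ { d_C(xb, xb') ≤ 2 : b, b' finite tuples in N with d_C(b, b') ≤ 1 }`. -/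
def SigmaType {C N : Set M} (hC : C ⊆ N) (X : Type u) : Set (L.Formula (N ⊕ X)) :=
  {ψ | ∃ (k : ℕ) (b b' : Fin k → N),
    DistLE L C 1 (fun i => (b i : M)) (fun i => (b' i : M)) ∧
      ∃ φ ∈ distType L C 2 (X ⊕ Fin k), ψ = Formula.relabel (substVars hC X b b') φ}

end Invariance

end PositiveLogic

/-! Thickness and saturation make each relation `d_C ≤ n` type-definable and determined by finite
subtuples (`IsMonster.isLocal_distOver`). Hence `Σ` says exactly that `α` turns distance at most one
between finite tuples of `N` into distance at most two after `α` is adjoined.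

Let `q` be Ls-invariant and let `b`, `b'` in `N` begin a `C`-indiscernible sequence. There is `A ⊇
C` of size at most `2^(|C|+λ_T)` that realises the types of finite tuples over all its subsets of
size at most `2^|T|`. An Erdős–Rado extraction (`IsMonster.exists_indiscernibleOver`) gives an
`A`-indiscernible sequence with the same positive formulas over `C`, and an automorphism over `C`
takes its first two terms to `b`, `b'` and `A` into `N`. Now `bA` and `b'A` have the same Lascar
type over `C`, so invariance gives `αb ≡_A αb'`.

Over so rich an `A`, equality of types already bounds the distance by two
(`IsMonster.distOver_two_of_sameType`): some `c` begins an indiscernible sequence with either tuple.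
By compactness it suffices to find approximations to `c` inside `A`. If there were none, one would
build in `A` a sequence of length `(2^|T|)⁺` whose terms realise the type of the given tuple over
the earlier ones. A single positive formula refuting the approximation would hold on all pairs from
an infinite subsequence, hence on an indiscernible sequence, which is absurd.

Conversely, if one realisation `α` satisfies `Σ`, a chain of length `n` between finite tuples of `N`
can be moved into `N`, so distance `n` becomes at most `2n`. The bound is uniform, so it passes to
infinite tuples by locality. Realisations of `q` are conjugate over `N`, so one of them decides for
all. -/

namespace PositiveLogic

/-! ### Closure properties and preservation of positive formulas. -/

section PositiveFormulas

variable {L : FirstOrder.Language.{u, u}}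

theorem IsPositive.boundedRelabel {X Y : Type*} {m n : ℕ} {φ : L.BoundedFormula X n}
    (hφ : IsPositive φ) (g : X → Y ⊕ Fin m) : IsPositive (φ.relabel g) := by
  induction hφ with
  | falsum => exact .falsum
  | verum => exact .verum
  | equal => exact .equal _ _
  | rel => exact .rel _ _
  | inf _ _ h₁ h₂ => exact .inf h₁ h₂
  | sup _ _ h₁ h₂ => exact .sup h₁ h₂
  | ex _ ih =>
    rw [BoundedFormula.relabel_ex]
    exact .ex ih

theorem IsPositive.relabel {X Y : Type*} {φ : L.Formula X} (hφ : IsPositive φ) (g : X → Y) :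
    IsPositive (Formula.relabel g φ) :=
  hφ.boundedRelabel _

theorem IsPositive.restrictFreeVar {X Y : Type*} [DecidableEq X] {n : ℕ}
    {φ : L.BoundedFormula X n} (hφ : IsPositive φ) :
    ∀ g : φ.freeVarFinset → Y, IsPositive (φ.restrictFreeVar g) := by
  induction hφ with
  | falsum => intro g; exact .falsum
  | verum => intro g; exact .verum
  | equal => intro g; exact .equal _ _
  | rel => intro g; exact .rel _ _
  | inf _ _ h₁ h₂ => intro g; exact .inf (h₁ _) (h₂ _)
  | sup _ _ h₁ h₂ => intro g; exact .sup (h₁ _) (h₂ _)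
  | ex _ ih => intro g; exact .ex (ih _)

theorem IsPositive.exs {X : Type*} : ∀ {n : ℕ} {φ : L.BoundedFormula X n},
    IsPositive φ → IsPositive φ.exs
  | 0, _, h => h
  | n + 1, φ, h => IsPositive.exs (n := n) (φ := φ.ex) (IsPositive.ex h)

theorem IsPositive.iExs {X Y : Type*} [Finite Y] {φ : L.Formula (X ⊕ Y)} (hφ : IsPositive φ) :
    IsPositive (Formula.iExs Y φ) :=
  (hφ.boundedRelabel _).exs

/-- A positive formula only depends on finitely many variables. -/
theorem IsPositive.exists_finset {X : Type*} {φ : L.Formula X} (hφ : IsPositive φ) :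
    ∃ (F : Finset X) (φ' : L.Formula F), IsPositive φ' ∧
      ∀ (K : Type u) [L.Structure K] (v : X → K),
        φ'.Realize (fun x : F => v x) ↔ φ.Realize v := by
  classical
  refine ⟨φ.freeVarFinset, φ.restrictFreeVar id, hφ.restrictFreeVar _, fun K _ v => ?_⟩
  exact BoundedFormula.realize_restrictFreeVar v (by simp)

/-- Existential quantification over an arbitrary tuple of variables. -/
theorem IsPositive.exists_projection {Y Z : Type*} {φ : L.Formula (Y ⊕ Z)} (hφ : IsPositive φ) :
    ∃ ψ : L.Formula Y, IsPositive ψ ∧ ∀ (K : Type u) [L.Structure K] [Nonempty K] (a : Y → K),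
      ψ.Realize a ↔ ∃ z : Z → K, φ.Realize (Sum.elim a z) := by
  classical
  let Z' := {z : Z // Sum.inr z ∈ φ.freeVarFinset}
  have : Finite Z' := Finite.of_injective (β := φ.freeVarFinset) (fun z => ⟨Sum.inr z.1, z.2⟩)
    (fun z w h => Subtype.ext (Sum.inr_injective (Subtype.ext_iff.1 h)))
  let f : φ.freeVarFinset → Y ⊕ Z' := fun p => match p with
    | ⟨Sum.inl y, _⟩ => Sum.inl y
    | ⟨Sum.inr z, h⟩ => Sum.inr ⟨z, h⟩
  refine ⟨Formula.iExs Z' (BoundedFormula.restrictFreeVar φ f), (hφ.restrictFreeVar f).iExs,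
    fun K _ _ a => ?_⟩
  have key : ∀ (z : Z → K) (z' : Z' → K), (∀ i : Z', z' i = z i) →
      (Formula.Realize (BoundedFormula.restrictFreeVar φ f) (Sum.elim a z') ↔
        φ.Realize (Sum.elim a z)) := by
    intro z z' h
    refine BoundedFormula.realize_restrictFreeVar (Sum.elim a z) ?_
    rintro ⟨y | z, hy⟩
    · rfl
    · exact h ⟨z, hy⟩
  rw [Formula.realize_iExs]
  constructor
  · rintro ⟨z', h⟩
    refine ⟨fun z => if hz : Sum.inr z ∈ φ.freeVarFinset then z' ⟨z, hz⟩
      else Classical.arbitrary K, (key _ _ ?_).1 h⟩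
    intro i
    rw [dif_pos i.2]
  · rintro ⟨z, h⟩
    exact ⟨fun i => z i, (key _ _ fun _ => rfl).2 h⟩

/-- The conjunction of finitely many positive formulas. -/
theorem exists_finset_inf {X : Type*} (Δ : Finset (L.Formula X)) (hΔ : ∀ φ ∈ Δ, IsPositive φ) :
    ∃ ψ : L.Formula X, IsPositive ψ ∧ ∀ (K : Type u) [L.Structure K] (v : X → K),
      ψ.Realize v ↔ ∀ φ ∈ Δ, φ.Realize v := by
  classical
  induction Δ using Finset.induction_on with
  | empty => exact ⟨⊤, .verum, fun K _ v => by simp⟩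
  | insert φ Δ _ ih =>
    obtain ⟨ψ, hψ, h⟩ := ih fun χ hχ => hΔ χ (Finset.mem_insert_of_mem hχ)
    exact ⟨φ ⊓ ψ, .inf (hΔ φ (Finset.mem_insert_self _ _)) hψ, fun K _ v => by simp [h]⟩

theorem isPositive_termEqual {X : Type*} (s t : L.Term X) : IsPositive (Term.equal s t) :=
  .equal _ _

/-- Homomorphisms preserve positive formulas. -/
theorem IsPositive.realize_hom {X : Type*} {K K' : Type u} [L.Structure K] [L.Structure K']
    (f : K →[L] K') {n : ℕ} {φ : L.BoundedFormula X n} (hφ : IsPositive φ) :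
    ∀ (v : X → K) (xs : Fin n → K), φ.Realize v xs → φ.Realize (f ∘ v) (f ∘ xs) := by
  induction hφ with
  | falsum => intro v xs h; exact h
  | verum => intro v xs _; exact BoundedFormula.realize_top.2 trivial
  | equal t₁ t₂ =>
    intro v xs h
    simp only [BoundedFormula.Realize, ← Sum.comp_elim, HomClass.realize_term] at h ⊢
    rw [h]
  | rel R ts =>
    intro v xs h
    simp only [BoundedFormula.Realize, ← Sum.comp_elim, HomClass.realize_term] at h ⊢
    exact f.map_rel R _ h
  | inf _ _ h₁ h₂ =>
    intro v xs h
    rw [BoundedFormula.realize_inf] at h ⊢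
    exact ⟨h₁ v xs h.1, h₂ v xs h.2⟩
  | sup _ _ h₁ h₂ =>
    intro v xs h
    rw [BoundedFormula.realize_sup] at h ⊢
    exact h.imp (h₁ v xs) (h₂ v xs)
  | ex _ ih =>
    intro v xs h
    rw [BoundedFormula.realize_ex] at h ⊢
    obtain ⟨a, ha⟩ := h
    refine ⟨f a, ?_⟩
    rw [← Fin.comp_snoc]
    exact ih v _ ha

/-- An immersion reflects positive formulas in arbitrary variables. -/
theorem IsImmersion.realize_of_realize {K K' : Type u} [L.Structure K] [L.Structure K']
    {f : K →[L] K'} (hf : IsImmersion f) {X : Type*} {φ : L.Formula X} (hφ : IsPositive φ)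
    (v : X → K) (h : φ.Realize (f ∘ v)) : φ.Realize v := by
  obtain ⟨F, φ', hφ', hF⟩ := hφ.exists_finset
  have e : F ≃ Fin F.card := F.equivFin
  have := hf _ (Formula.relabel e φ') (hφ'.relabel e) (fun i => v (e.symm i)) (by
    rw [Formula.realize_relabel, ← hF] at *
    convert h using 2 with x
    simp)
  rw [Formula.realize_relabel] at this
  rw [← hF]
  convert this using 2 with x
  simp

theorem realize_equiv {X : Type*} {K K' : Type u} [L.Structure K] [L.Structure K']
    (f : K ≃[L] K') (φ : L.Formula X) (v : X → K) :
    φ.Realize (fun x => f (v x)) ↔ φ.Realize v :=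
  StrongHomClass.realize_formula f φ

end PositiveFormulas

/-! ### Positive types in e.c. models are maximal. -/

section Maximality

variable {L : FirstOrder.Language.{u, u}} {T : L.Theory} {M : Type u} [L.Structure M]

/-- In an e.c. model, the failure of a positive formula is witnessed by a positive formula. -/
theorem IsEC.exists_contradicting [Nonempty M] (hM : IsEC T M) {Y : Type*} {φ : L.Formula Y}
    (hφ : IsPositive φ) {a : Y → M} (ha : ¬ φ.Realize a) :
    ∃ ψ : L.Formula Y, IsPositive ψ ∧ ψ.Realize a ∧
      ∀ c : Y → M, ψ.Realize c → ¬ φ.Realize c := by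
  classical
  by_contra hcon
  push Not at hcon
  obtain ⟨F, φ', hφ', hF⟩ := hφ.exists_finset
  -- The positive diagram of `M`. Each finite part of it is satisfied by a map `v : M → M` with `φ`
  -- true at `v ∘ a`. The ultraproduct of these maps is a homomorphism into an ultrapower of `M`;
  -- being an immersion, it reflects `φ` back to `a`.
  let Pos := {χ : L.Formula M // IsPositive χ ∧ χ.Realize (fun m : M => m)}
  have step : ∀ Δ : Finset Pos, ∃ v : M → M, (∀ χ ∈ Δ, χ.1.Realize v) ∧
      φ'.Realize (fun x : F => v (a x)) := by
    intro Δ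
    obtain ⟨χ, hχ, hχΔ⟩ := exists_finset_inf (Δ.image Subtype.val) (fun χ h => by
      obtain ⟨χ, -, rfl⟩ := Finset.mem_image.1 h
      exact χ.2.1)
    obtain ⟨ε, hε, hεF⟩ := exists_finset_inf (L := L) (X := Y ⊕ M)
      (F.image fun x => Term.equal (Term.var (Sum.inl x)) (Term.var (Sum.inr (a x))))
      (fun χ h => by
        obtain ⟨x, -, rfl⟩ := Finset.mem_image.1 h
        exact isPositive_termEqual _ _)
    -- `ψ(y)` says that some map on `M` satisfies the finite diagram and sends `a x` to `y x` for `x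
    -- ∈ F`. The identity shows that it holds at `a`.
    obtain ⟨ψ, hψ, hψe⟩ := ((hχ.relabel (Sum.inr : M → Y ⊕ M)).inf hε).exists_projection
    have hψa : ψ.Realize a := by
      rw [hψe]
      refine ⟨fun m => m, ?_⟩
      rw [Formula.realize_inf, Formula.realize_relabel]
      refine ⟨(hχΔ _ _).2 fun χ h => ?_, (hεF _ _).2 fun χ h => ?_⟩
      · obtain ⟨χ, -, rfl⟩ := Finset.mem_image.1 h
        exact χ.2.2
      · obtain ⟨x, -, rfl⟩ := Finset.mem_image.1 h
        simp [Term.equal, Term.bdEqual, Formula.Realize, BoundedFormula.Realize]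
    obtain ⟨c, hc, hcφ⟩ := hcon ψ hψ hψa
    obtain ⟨v, hv⟩ := (hψe _ _).1 hc
    rw [Formula.realize_inf, Formula.realize_relabel] at hv
    refine ⟨v, fun χ h => (hχΔ _ _).1 hv.1 _ (Finset.mem_image_of_mem _ h), ?_⟩
    rw [← hF] at hcφ
    convert hcφ using 2 with x
    have := (hεF _ _).1 hv.2 _ (Finset.mem_image_of_mem _ x.2)
    simpa [Term.equal, Term.bdEqual, Formula.Realize, BoundedFormula.Realize] using this.symm
  choose v hv hvφ using step
  let U : Ultrafilter (Finset Pos) := Ultrafilter.of Filter.atTop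
  let K : Type u := (U : Filter (Finset Pos)).Product fun _ => M
  have hU : ∀ χ : Pos, ∀ᶠ Δ in (U : Filter (Finset Pos)), χ.1.Realize (v Δ) := fun χ =>
    Ultrafilter.of_le Filter.atTop <|
      (Filter.eventually_ge_atTop {χ}).mono fun Δ h => hv Δ χ (Finset.singleton_subset_iff.1 h)
  let g : M → K := fun m => ((fun Δ => v Δ m : Finset Pos → M) : K)
  have hg : ∀ (χ : L.Formula M), IsPositive χ → χ.Realize (fun m => m) → χ.Realize g := by
    intro χ hχ h
    exact (Ultraproduct.realize_formula_cast (M := fun _ : Finset Pos => M) (u := U) χ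
      (fun m Δ => v Δ m)).2 (hU ⟨χ, hχ, h⟩)
  have hK : K ⊨ T := ⟨fun σ hσ => (Ultraproduct.sentence_realize σ).2
    (Filter.Eventually.of_forall fun _ => hM.1.realize_of_mem σ hσ)⟩
  let f : M →[L] K :=
    { toFun := g
      map_fun' := by
        intro n F x
        have := hg (Term.equal (Term.var (Structure.funMap F x)) (Term.func F fun i => Term.var (x i)))
          (isPositive_termEqual _ _) (by
            simp [Term.equal, Term.bdEqual, Formula.Realize, BoundedFormula.Realize])
        simpa [Term.equal, Term.bdEqual, Formula.Realize, BoundedFormula.Realize, Function.comp_def]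
          using this
      map_rel' := by
        intro n R x hx
        have := hg (R.formula fun i => Term.var (x i)) (.rel _ _) (by
          simpa [Formula.realize_rel] using hx)
        simpa [Formula.realize_rel, Function.comp_def] using this }
  have hfa : φ'.Realize (f ∘ fun x : F => a x) :=
    (Ultraproduct.realize_formula_cast (M := fun _ : Finset Pos => M) (u := U) φ'
      (fun x Δ => v Δ (a x))).2 (Filter.Eventually.of_forall hvφ)
  exact ha ((hF _ _).1 ((hM.2 K hK f).realize_of_realize hφ' _ hfa))

/-- In an e.c. model, the positive type of a tuple is maximal. -/
theorem IsEC.realize_iff_of_imp [Nonempty M] (hM : IsEC T M) {Y : Type*} {a b : Y → M}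
    (h : ∀ φ : L.Formula Y, IsPositive φ → φ.Realize a → φ.Realize b) {φ : L.Formula Y}
    (hφ : IsPositive φ) : φ.Realize a ↔ φ.Realize b := by
  refine ⟨h φ hφ, fun hb => ?_⟩
  by_contra ha
  obtain ⟨ψ, hψ, hψa, hψφ⟩ := hM.exists_contradicting hφ ha
  exact hψφ b (h ψ hψ hψa) hb

end Maximality

/-! ### Closing-off arguments and the Erdős–Rado theorem. -/

section Combinatorics

/-- Closing off a set under operations of a fixed arity. -/
theorem exists_closed_set {S W O : Type u} (f : O → (W → S) → S) (C : Set S) {μ : Cardinal.{u}}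
    (hμ : ℵ₀ ≤ μ) (hC : #C ≤ μ) (hO : #O ≤ μ) (hW : μ ^ #W ≤ μ) :
    ∃ A : Set S, C ⊆ A ∧ #A ≤ μ ∧ ∀ o t, (∀ w, t w ∈ A) → f o t ∈ A := by
  -- The closure is the set of values of well-founded terms with constants from `C` and operations
  -- from `O` of arity `W`.
  let β : C ⊕ O → Type u := Sum.elim (fun _ => PEmpty) (fun _ => W)
  let ev : WType β → S := WType.elim S fun x => match x with
    | ⟨Sum.inl c, _⟩ => c
    | ⟨Sum.inr o, t⟩ => f o t
  have hcard : #(WType β) ≤ μ := by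
    refine WType.cardinalMk_le_of_le ?_
    refine (Cardinal.sum_le_sum _ (fun _ => μ) ?_).trans ?_
    · rintro (c | o)
      · simpa [β] using Cardinal.one_le_aleph0.trans hμ
      · exact hW
    · rw [Cardinal.sum_const', Cardinal.mk_sum, Cardinal.lift_id, Cardinal.lift_id]
      calc (#C + #O) * μ ≤ (μ + μ) * μ := by gcongr
        _ = μ := by rw [Cardinal.add_eq_self hμ, Cardinal.mul_eq_self hμ]
  refine ⟨Set.range ev, fun c hc => ⟨WType.mk (Sum.inl ⟨c, hc⟩) PEmpty.elim, rfl⟩,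
    Cardinal.mk_range_le.trans hcard, fun o t ht => ?_⟩
  choose g hg using ht
  refine ⟨WType.mk (Sum.inr o) g, ?_⟩
  change f o (fun w => ev (g w)) = f o t
  congr 1
  exact funext hg

theorem exists_wf_sequence {I : Type*} {V : Type*} [LT I] [WellFoundedLT I]
    (P : ∀ i : I, (∀ j, j < i → V) → V → Prop) (h : ∀ i g, ∃ v, P i g v) :
    ∃ f : I → V, ∀ i, P i (fun j _ => f j) (f i) := by
  choose F hF using h
  refine ⟨(wellFounded_lt (α := I)).fix F, fun i => ?_⟩
  conv => arg 3; rw [WellFounded.fix_eq]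
  exact hF i _

/-- By Ramsey an injective sequence has an increasing or a non-increasing subsequence; the second
would be strictly descending. -/
theorem exists_strictMono_nat (I : Type*) [LinearOrder I] [WellFoundedLT I] [Infinite I] :
    ∃ f : ℕ → I, StrictMono f := by
  let e := Infinite.natEmbedding I
  obtain ⟨g, h | h⟩ := exists_increasing_or_nonincreasing_subseq (· < ·) e
  · exact ⟨fun n => e (g n), fun m n hmn => h m n hmn⟩
  · exfalso
    have hanti : ∀ m n, m < n → e (g n) < e (g m) := fun m n hmn =>
      lt_of_le_of_ne (not_lt.1 (h m n hmn)) fun he =>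
        hmn.ne' (g.injective (e.injective he))
    exact (RelEmbedding.natGT (r := ((· < ·) : I → I → Prop)) (fun n => e (g n))
      (fun n => hanti n (n + 1) n.lt_succ_self)).not_wellFounded wellFounded_lt

/-- Iterated exponential starting at `μ`. -/
noncomputable def iterExp (μ : Cardinal.{u}) : ℕ → Cardinal.{u}
  | 0 => μ
  | n + 1 => 2 ^ iterExp μ n

theorem le_iterExp (μ : Cardinal.{u}) : ∀ n, μ ≤ iterExp μ n
  | 0 => le_rfl
  | n + 1 => (le_iterExp μ n).trans (Cardinal.cantor _).le

theorem mk_Iio_succ_ord_le {ν : Cardinal.{u}} (i : (Order.succ ν).ord.ToType) :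
    #(Set.Iio i) ≤ ν :=
  Order.lt_succ_iff.1 ((Cardinal.mk_Iio_lt i (by simp)).trans_eq (Cardinal.mk_ord_toType _))

theorem exists_surjective_of_mk_le {W B : Type u} [Nonempty B] (h : #B ≤ #W) :
    ∃ t : W → B, Function.Surjective t := by
  obtain ⟨e⟩ := h
  exact ⟨Function.invFun e, Function.invFun_surjective e.injective⟩

/-- Every colouring of the increasing `(n + 1)`-tuples of `(2 ^ ν)⁺` is end-homogeneous on a set of
order type `ν⁺`. -/
theorem exists_endHomogeneous {n : ℕ} {ν : Cardinal.{u}} (hν : ℵ₀ ≤ ν) {Z : Type u} (hZ : #Z ≤ ν)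
    {I : Type u} [LinearOrder I]
    (hI : #I = Order.succ ((2 : Cardinal.{u}) ^ ν)) (hIio : ∀ i : I, #(Set.Iio i) ≤ 2 ^ ν)
    (c : (Fin (n + 1) → I) → Z) :
    ∃ (h : (Order.succ ν).ord.ToType → I)
      (y : I), StrictMono h ∧
      ∀ (i : Fin n → (Order.succ ν).ord.ToType) (j : (Order.succ ν).ord.ToType),
        (∀ k, i k < j) → c (Fin.snoc (α := fun _ => _) (h ∘ i) (h j)) =
          c (Fin.snoc (α := fun _ => _) (h ∘ i) y) := by
  classical
  have h2ν : ℵ₀ ≤ (2 : Cardinal.{u}) ^ ν := hν.trans (Cardinal.cantor ν).le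
  have : Nonempty I := Cardinal.mk_ne_zero_iff.1 (by rw [hI]; exact (Order.bot_lt_succ _).ne')
  obtain ⟨a₀⟩ := this
  let W : Type u := ν.out
  have hW : #W = ν := Cardinal.mk_out ν
  -- A point above `t` whose colours with the tuples from `t` follow the pattern `p`. The set `A`
  -- below is closed under choosing such points, so anything outside can be imitated in `A` over `ν`
  -- many points.
  let good : ((Fin n → W) → Z) → (W → I) → I → Prop := fun p t y =>
    (∀ w, t w < y) ∧ ∀ i : Fin n → W, c (Fin.snoc (α := fun _ => I) (t ∘ i) y) = p i
  let f : ((Fin n → W) → Z) → (W → I) → I := fun p t =>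
    if h : ∃ y, good p t y then h.choose else a₀
  have hpow : ((2 : Cardinal.{u}) ^ ν) ^ ν = 2 ^ ν := by
    rw [← Cardinal.power_mul, Cardinal.mul_eq_self hν]
  obtain ⟨A, ha₀, hA, hclosed⟩ := exists_closed_set f {a₀} h2ν
    (by rw [Cardinal.mk_singleton]; exact Cardinal.one_le_aleph0.trans h2ν) (by
      rw [← Cardinal.power_def]
      calc #Z ^ #(Fin n → W) ≤ (2 ^ ν) ^ ν := by
            refine (Cardinal.power_le_power_right (hZ.trans (Cardinal.cantor ν).le)).trans
              (Cardinal.power_le_power_left (Cardinal.power_ne_zero _ two_ne_zero) ?_)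
            rw [Cardinal.mk_arrow, hW]
            simpa using Cardinal.power_nat_le (n := n) hν
        _ = 2 ^ ν := hpow) (by rw [hW, hpow])
  have ha₀ : a₀ ∈ A := ha₀ rfl
  -- Otherwise `I` would be covered by `2 ^ ν` initial segments of size at most `2 ^ ν`.
  have hbdd : ∃ y : I, ∀ a ∈ A, a < y := by
    by_contra hcon
    push Not at hcon
    have hcover : (Set.univ : Set I) ⊆ ⋃ a : A, insert (a : I) (Set.Iio (a : I)) := by
      intro y _
      obtain ⟨a, ha, hya⟩ := hcon y
      exact Set.mem_iUnion.2 ⟨⟨a, ha⟩, (eq_or_lt_of_le hya).elim Or.inl Or.inr⟩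
    have h1 := (Cardinal.mk_le_mk_of_subset hcover).trans (Cardinal.mk_iUnion_le _)
    rw [Cardinal.mk_univ, hI] at h1
    have h2 : (⨆ a : A, #(insert (a : I) (Set.Iio (a : I)) : Set I)) ≤ 2 ^ ν := by
      refine ciSup_le' fun a => Cardinal.mk_insert_le.trans ?_
      exact (add_le_add (hIio _)
        (Cardinal.one_le_aleph0.trans h2ν)).trans_eq (Cardinal.add_eq_self h2ν)
    have h3 := h1.trans ((mul_le_mul' hA h2).trans_eq (Cardinal.mul_eq_self h2ν))
    exact absurd h3 (not_le.2 (Order.lt_succ _))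
  obtain ⟨y, hy⟩ := hbdd
  have hstep : ∀ B : Set I, B ⊆ A → #B ≤ ν → ∃ y' ∈ A, (∀ b ∈ B, b < y') ∧
      ∀ i : Fin n → I, (∀ k, i k ∈ B) →
        c (Fin.snoc (α := fun _ => I) i y') = c (Fin.snoc (α := fun _ => I) i y) := by
    intro B hBA hB
    have hB' : #(insert a₀ B : Set I) ≤ #W := by
      rw [hW]
      exact Cardinal.mk_insert_le.trans ((add_le_add hB
        (Cardinal.one_le_aleph0.trans hν)).trans_eq (Cardinal.add_eq_self hν))
    have : Nonempty (insert a₀ B : Set I) := ⟨⟨a₀, Set.mem_insert _ _⟩⟩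
    obtain ⟨t, ht⟩ := exists_surjective_of_mk_le hB'
    let t' : W → I := fun w => t w
    let p : (Fin n → W) → Z := fun i => c (Fin.snoc (α := fun _ => I) (t' ∘ i) y)
    have htA : ∀ w, t' w ∈ A := fun w => (t w).2.elim (fun h => by
      change (t w : I) ∈ A
      rw [h]; exact ha₀) fun h => hBA h
    have hex : ∃ y, good p t' y := ⟨y, fun w => hy _ (htA w), fun i => rfl⟩
    have hf : good p t' (f p t') := by
      change good p t' (if h : ∃ y, good p t' y then h.choose else a₀)
      rw [dif_pos hex]
      exact hex.choose_spec
    refine ⟨f p t', hclosed p t' htA, fun b hb => ?_, fun i hi => ?_⟩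
    · obtain ⟨w, hw⟩ := ht ⟨b, Set.mem_insert_of_mem _ hb⟩
      have := hf.1 w
      rwa [show t' w = b from congrArg Subtype.val hw] at this
    · choose w hw using fun k => ht ⟨i k, Set.mem_insert_of_mem _ (hi k)⟩
      have hti : t' ∘ w = i := funext fun k => congrArg Subtype.val (hw k)
      have := hf.2 w
      rw [hti] at this
      rw [this, ← hti]
  obtain ⟨h, hh⟩ := exists_wf_sequence (I := (Order.succ ν).ord.ToType) (V := A)
    (fun j g v => (∀ i (hi : i < j), (g i hi : I) < v) ∧
      ∀ i : Fin n → (Order.succ ν).ord.ToType, ∀ hi : ∀ k, i k < j,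
        c (Fin.snoc (α := fun _ => I) (fun k => (g (i k) (hi k) : I)) v) =
          c (Fin.snoc (α := fun _ => I) (fun k => (g (i k) (hi k) : I)) y)) (by
      intro j g
      obtain ⟨y', hy', h1, h2⟩ := hstep (Set.range fun i : Set.Iio j => (g i.1 i.2 : I))
        (by rintro _ ⟨i, rfl⟩; exact (g i.1 i.2).2)
        (Cardinal.mk_range_le.trans (mk_Iio_succ_ord_le j))
      exact ⟨⟨y', hy'⟩, fun i hi => h1 _ ⟨⟨i, hi⟩, rfl⟩,
        fun i hi => h2 _ fun k => ⟨⟨i k, hi k⟩, rfl⟩⟩)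
  exact ⟨fun j => h j, y, fun i j hij => (hh j).1 i hij, fun i j hij => (hh j).2 i hij⟩

/-- Erdős–Rado: colourings of increasing `n`-tuples with `μ` colours have infinite homogeneous
sequences on long well-orders. -/
theorem erdos_rado {μ : Cardinal.{u}} (hμ : ℵ₀ ≤ μ) {Z : Type u} (hZ : #Z ≤ μ) (n : ℕ) :
    ∀ (I : Type u) [LinearOrder I] [WellFoundedLT I], iterExp μ n < #I → ∀ c : (Fin n → I) → Z,
      ∃ f : ℕ → I, StrictMono f ∧ ∀ i j : Fin n → ℕ, StrictMono i → StrictMono j →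
        c (f ∘ i) = c (f ∘ j) := by
  induction n with
  | zero =>
    intro I _ _ hI c
    have : Infinite I := Cardinal.infinite_iff.2 (hμ.trans hI.le)
    obtain ⟨f, hf⟩ := exists_strictMono_nat I
    exact ⟨f, hf, fun i j _ _ => congrArg c (Subsingleton.elim _ _)⟩
  | succ n ih =>
    intro I _ _ hI c
    set ν := iterExp μ n
    have hμν : μ ≤ ν := le_iterExp μ n
    -- Passing to a copy of `(2 ^ ν)⁺` in `I` makes proper initial segments small. End-homogeneity
    -- then lets the fixed point `y` stand in for the last coordinate, which leaves a colouring of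
    -- `n`-tuples on `ν⁺`.
    have hle : (Order.succ ((2 : Cardinal.{u}) ^ ν)).ord ≤
        Ordinal.type ((· < ·) : I → I → Prop) := by
      rw [Cardinal.ord_le, Ordinal.card_type]
      exact Order.succ_le_of_lt hI
    rw [← Ordinal.type_toType (Order.succ ((2 : Cardinal.{u}) ^ ν)).ord, Ordinal.type_le_iff'] at hle
    obtain ⟨e⟩ := hle
    have he : StrictMono e := fun a b h => e.map_rel_iff.2 h
    obtain ⟨h, y, hh, hc⟩ := exists_endHomogeneous (hμ.trans hμν) (hZ.trans hμν)
      (Cardinal.mk_ord_toType _) mk_Iio_succ_ord_le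
      (fun i => c (e ∘ i))
    obtain ⟨f, hf, hfc⟩ := ih (Order.succ ν).ord.ToType
      (by rw [Cardinal.mk_ord_toType]; exact Order.lt_succ _)
      (fun i => c (e ∘ Fin.snoc (α := fun _ => _) (h ∘ i) y))
    refine ⟨fun k => e (h (f k)), he.comp (hh.comp hf), fun i j hi hj => ?_⟩
    have key : ∀ i : Fin (n + 1) → ℕ, StrictMono i →
        c ((fun k => e (h (f k))) ∘ i) =
          c (e ∘ Fin.snoc (α := fun _ => _) (h ∘ (f ∘ fun k : Fin n => i k.castSucc)) y) := by
      intro i hi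
      rw [← hc (f ∘ fun k : Fin n => i k.castSucc) (f (i (Fin.last n)))
        fun k => hf (hi (Fin.castSucc_lt_last k))]
      congr 1
      funext k
      refine Fin.lastCases ?_ (fun k => ?_) k <;> simp
    rw [key i hi, key j hj]
    exact hfc _ _ (fun a b hab => hi (Fin.castSucc_lt_castSucc_iff.2 hab))
      (fun a b hab => hj (Fin.castSucc_lt_castSucc_iff.2 hab))

end Combinatorics

/-! ### Saturation with parameters given by a tuple. -/

section Saturation

variable {L : FirstOrder.Language.{u, u}} {K : Type u} [L.Structure K] {κ : Cardinal.{u}}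

theorem IsSaturated.exists_realize (h : IsSaturated L K κ) {Y Z : Type u} (hY : #Y < κ)
    (hZ : #Z < κ) (a : Y → K) (Γ : Set (L.Formula (Y ⊕ Z))) (hΓ : ∀ φ ∈ Γ, IsPositive φ)
    (hfin : ∀ Δ : Finset (L.Formula (Y ⊕ Z)), (Δ : Set (L.Formula (Y ⊕ Z))) ⊆ Γ →
      ∃ z : Z → K, ∀ φ ∈ Δ, φ.Realize (Sum.elim a z)) :
    ∃ z : Z → K, ∀ φ ∈ Γ, φ.Realize (Sum.elim a z) := by
  classical
  let r : L.Formula (Y ⊕ Z) → L.Formula (Set.range a ⊕ Z) :=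
    Formula.relabel (Sum.map (Set.rangeFactorization a) id)
  have hr : ∀ (φ : L.Formula (Y ⊕ Z)) (z : Z → K),
      (r φ).Realize (Sum.elim (fun c : Set.range a => (c : K)) z) ↔
        φ.Realize (Sum.elim a z) := by
    intro φ z
    rw [Formula.realize_relabel, Sum.elim_comp_map]
    rfl
  obtain ⟨z, hz⟩ := h (Set.range a) (Cardinal.mk_range_le.trans_lt hY) Z hZ (r '' Γ)
    (by rintro _ ⟨φ, hφ, rfl⟩; exact (hΓ φ hφ).relabel _) (by
      intro Δ hΔ
      obtain ⟨Δ', hΔ', rfl⟩ := Finset.subset_set_image_iff.1 hΔ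
      obtain ⟨z, hz⟩ := hfin Δ' hΔ'
      refine ⟨z, fun φ hφ => ?_⟩
      obtain ⟨χ, hχ, rfl⟩ := Finset.mem_image.1 hφ
      exact (hr χ z).2 (hz χ hχ))
  exact ⟨z, fun φ hφ => (hr φ z).1 (hz _ ⟨φ, hφ, rfl⟩)⟩

/-- In a directed set one member implies any given finite part, so only single formulas need to be
satisfied. -/
theorem IsSaturated.exists_realize_of_directed (h : IsSaturated L K κ) {Y Z : Type u}
    (hY : #Y < κ) (hZ : #Z < κ) (a : Y → K) (Γ : Set (L.Formula (Y ⊕ Z)))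
    (hΓ : ∀ φ ∈ Γ, IsPositive φ) (hne : Γ.Nonempty)
    (hdir : ∀ φ ∈ Γ, ∀ ψ ∈ Γ, ∃ χ ∈ Γ, ∀ v : Y ⊕ Z → K, χ.Realize v → φ.Realize v ∧ ψ.Realize v)
    (hsat : ∀ φ ∈ Γ, ∃ z : Z → K, φ.Realize (Sum.elim a z)) :
    ∃ z : Z → K, ∀ φ ∈ Γ, φ.Realize (Sum.elim a z) := by
  classical
  refine h.exists_realize hY hZ a Γ hΓ fun Δ hΔ => ?_
  have : ∃ χ ∈ Γ, ∀ v : Y ⊕ Z → K, χ.Realize v → ∀ φ ∈ Δ, φ.Realize v := by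
    induction Δ using Finset.induction_on with
    | empty => exact ⟨hne.choose, hne.choose_spec, fun v _ φ hφ => by simp at hφ⟩
    | insert φ Δ _ ih =>
      rw [Finset.coe_insert, Set.insert_subset_iff] at hΔ
      obtain ⟨χ, hχ, h1⟩ := ih hΔ.2
      obtain ⟨θ, hθ, h2⟩ := hdir φ hΔ.1 χ hχ
      refine ⟨θ, hθ, fun v hv ψ hψ => ?_⟩
      rcases Finset.mem_insert.1 hψ with rfl | hψ
      · exact (h2 v hv).1
      · exact h1 v (h2 v hv).2 ψ hψ
  obtain ⟨χ, hχ, h1⟩ := this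
  obtain ⟨z, hz⟩ := hsat χ hχ
  exact ⟨z, h1 _ hz⟩

end Saturation

/-! ### Cardinal bounds below the monster's `κ`. -/

section Cardinalities

variable {L : FirstOrder.Language.{u, u}}

theorem aleph0_le_theoryCard : ℵ₀ ≤ theoryCard L := le_max_left _ _

theorem mk_formula_le (Y : Type u) : #(L.Formula Y) ≤ max #Y (theoryCard L) := by
  have h1 : #(L.Formula Y) ≤ #(Σ n, L.BoundedFormula Y n) :=
    Cardinal.mk_le_of_injective (f := fun φ => (⟨0, φ⟩ : Σ n, L.BoundedFormula Y n))
      fun φ ψ h => by simpa using h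
  refine h1.trans (BoundedFormula.card_le.trans ?_)
  rw [Cardinal.lift_id, Cardinal.lift_id]
  refine max_le ((le_max_left _ _).trans (le_max_right _ _)) ?_
  refine Cardinal.add_le_of_le ((aleph0_le_theoryCard (L := L)).trans (le_max_right _ _))
    (le_max_left _ _) ((le_max_right _ _).trans (le_max_right _ _))

variable {T : L.Theory} {κ : Cardinal.{u}} {M : Type u} [L.Structure M]

namespace IsMonster

theorem aleph0_lt (h : IsMonster T κ M) : ℵ₀ < κ :=
  aleph0_le_theoryCard.trans_lt h.theory_small

theorem two_power_lt (h : IsMonster T κ M) {μ : Cardinal.{u}} (hμ : μ < κ) : 2 ^ μ < κ :=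
  ((Order.le_succ _).trans (Cardinal.le_beth_ord _)).trans_lt (h.beth_small μ hμ)

theorem succ_lt (h : IsMonster T κ M) {μ : Cardinal.{u}} (hμ : μ < κ) : Order.succ μ < κ :=
  (Order.succ_le_of_lt (Cardinal.cantor μ)).trans_lt (h.two_power_lt hμ)

theorem iterExp_lt (h : IsMonster T κ M) {μ : Cardinal.{u}} (hμ : μ < κ) :
    ∀ n, iterExp μ n < κ
  | 0 => hμ
  | n + 1 => h.two_power_lt (h.iterExp_lt hμ n)

theorem mk_formula_lt (h : IsMonster T κ M) {Y : Type u} (hY : #Y < κ) : #(L.Formula Y) < κ :=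
  (mk_formula_le Y).trans_lt (max_lt hY h.theory_small)

theorem mk_sum_lt (h : IsMonster T κ M) {Y Z : Type u} (hY : #Y < κ) (hZ : #Z < κ) :
    #(Y ⊕ Z) < κ := by
  rw [Cardinal.mk_sum, Cardinal.lift_id, Cardinal.lift_id]
  exact Cardinal.add_lt_of_lt h.aleph0_lt.le hY hZ

theorem mk_prod_lt (h : IsMonster T κ M) {I Z : Type u} (hI : #I < κ) (hZ : #Z < κ) :
    #(I × Z) < κ := by
  rw [Cardinal.mk_prod, Cardinal.lift_id, Cardinal.lift_id]
  exact Cardinal.mul_lt_of_lt h.aleph0_lt.le hI hZ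

theorem mk_finite_lt (h : IsMonster T κ M) (Z : Type u) [Finite Z] : #Z < κ :=
  (Cardinal.lt_aleph0_of_finite Z).trans h.aleph0_lt

theorem mk_countable_prod_lt (h : IsMonster T κ M) (I : Type) [Countable I] {Z : Type u}
    (hZ : #Z < κ) : #(I × Z) < κ := by
  rw [Cardinal.mk_prod, Cardinal.lift_uzero]
  refine Cardinal.mul_lt_of_lt h.aleph0_lt.le (lt_of_le_of_lt ?_ h.aleph0_lt) hZ
  rw [Cardinal.lift_le_aleph0]
  exact Cardinal.mk_le_aleph0

end IsMonster

end Cardinalities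

/-! ### Extraction of indiscernible sequences. -/

section Extraction

variable {L : FirstOrder.Language.{u, u}} {M : Type u} [L.Structure M]

variable (L) in
/-- Indiscernibility over a tuple of parameters. -/
def IndiscernibleOver {E X : Type*} (e : E → M) (s : ℕ → X → M) : Prop :=
  ∀ (n : ℕ) (i j : Fin n → ℕ), StrictMono i → StrictMono j →
    ∀ φ : L.Formula (E ⊕ (Fin n × X)), IsPositive φ →
      (φ.Realize (Sum.elim e fun p => s (i p.1) p.2) ↔
        φ.Realize (Sum.elim e fun p => s (j p.1) p.2))

/-- All increasing tuples of the sequence `s` satisfy the formulas in `Φ` over `e`. -/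
def EMRealizes {E X I : Type*} [Preorder I] (e : E → M)
    (Φ : Set (Σ n : ℕ, L.Formula (E ⊕ (Fin n × X)))) (s : I → X → M) : Prop :=
  ∀ p ∈ Φ, ∀ i : Fin p.1 → I, StrictMono i → p.2.Realize (Sum.elim e fun q => s (i q.1) q.2)

theorem EMRealizes.mono {E X I : Type*} [Preorder I] {e : E → M}
    {Φ Ψ : Set (Σ n : ℕ, L.Formula (E ⊕ (Fin n × X)))} {s : I → X → M} (h : EMRealizes e Ψ s)
    (hΦ : Φ ⊆ Ψ) : EMRealizes e Φ s :=
  fun p hp => h p (hΦ hp)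

theorem EMRealizes.comp {E X I J : Type*} [Preorder I] [Preorder J] {e : E → M}
    {Φ : Set (Σ n : ℕ, L.Formula (E ⊕ (Fin n × X)))} {s : I → X → M} (h : EMRealizes e Φ s)
    {f : J → I} (hf : StrictMono f) : EMRealizes e Φ (fun j => s (f j)) :=
  fun p hp i hi => h p hp (fun k => f (i k)) (hf.comp hi)

variable {T : L.Theory} {κ : Cardinal.{u}}

/-- Compactness stretches sequences indexed by `ℕ` to any small linear order, since finitely many
conditions mention only finitely many indices. -/
theorem IsMonster.exists_emRealizes (h : IsMonster T κ M) {E X I : Type u} [LinearOrder I]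
    (hE : #E < κ) (hX : #X < κ) (hI : #I < κ) (e : E → M)
    (Φ : Set (Σ n : ℕ, L.Formula (E ⊕ (Fin n × X)))) (hΦ : ∀ p ∈ Φ, IsPositive p.2)
    (hfin : ∀ Δ : Finset (Σ n : ℕ, L.Formula (E ⊕ (Fin n × X))),
      (Δ : Set (Σ n : ℕ, L.Formula (E ⊕ (Fin n × X)))) ⊆ Φ →
        ∃ s : ℕ → X → M, EMRealizes e (Δ : Set (Σ n : ℕ, L.Formula (E ⊕ (Fin n × X)))) s) :
    ∃ s : I → X → M, EMRealizes e Φ s := by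
  classical
  let P := Σ p : (Σ n : ℕ, L.Formula (E ⊕ (Fin n × X))), Fin p.1 → I
  let g : P → L.Formula (E ⊕ (I × X)) := fun p =>
    Formula.relabel (Sum.map id fun q => (p.2 q.1, q.2)) p.1.2
  have hg : ∀ (p : P) (z : I × X → M), (g p).Realize (Sum.elim e z) ↔
      p.1.2.Realize (Sum.elim e fun q => z (p.2 q.1, q.2)) := by
    intro p z
    rw [Formula.realize_relabel, Sum.elim_comp_map]
    rfl
  obtain ⟨z, hz⟩ := h.saturated.exists_realize hE
    (h.mk_prod_lt hI hX) e
    (g '' {p | p.1 ∈ Φ ∧ StrictMono p.2})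
    (by rintro _ ⟨p, hp, rfl⟩; exact (hΦ _ hp.1).relabel _) (by
      intro Δ hΔ
      obtain ⟨D, hD, rfl⟩ := Finset.subset_set_image_iff.1 hΔ
      obtain ⟨s, hs⟩ := hfin (D.image Sigma.fst) (by
        intro p hp
        obtain ⟨p', hp', rfl⟩ := Finset.mem_image.1 hp
        exact (hD hp').1)
      let J : Finset I := D.biUnion fun p => Finset.univ.image p.2
      -- The rank among the finitely many relevant indices; it is strictly increasing on `J`.
      let r : I → ℕ := fun x => (J.filter (· < x)).card
      have hr : ∀ x ∈ J, ∀ y, x < y → r x < r y := by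
        intro x hx y hxy
        refine Finset.card_lt_card (Finset.ssubset_iff_of_subset ?_ |>.2 ⟨x, ?_, ?_⟩)
        · exact Finset.monotone_filter_right J fun a _ ha => lt_trans ha hxy
        · exact Finset.mem_filter.2 ⟨hx, hxy⟩
        · simp
      refine ⟨fun q => s (r q.1) q.2, fun φ hφ => ?_⟩
      obtain ⟨p, hp, rfl⟩ := Finset.mem_image.1 hφ
      rw [hg]
      refine hs p.1 (Finset.mem_coe.2 (Finset.mem_image_of_mem _ hp)) (fun k => r (p.2 k))
        fun a b hab => hr _ ?_ _ ((hD hp).2 hab)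
      exact Finset.mem_biUnion.2 ⟨p, hp, Finset.mem_image_of_mem _ (Finset.mem_univ _)⟩)
  refine ⟨fun i x => z (i, x), fun p hp i hi => ?_⟩
  exact (hg ⟨p, i⟩ z).1 (hz _ ⟨⟨p, i⟩, ⟨hp, hi⟩, rfl⟩)

/-- Every sequence gives rise to an indiscernible sequence satisfying all the positive formulas
prescribed for increasing tuples. -/
theorem IsMonster.exists_indiscernibleOver [Nonempty M] (h : IsMonster T κ M) {E X : Type u}
    (hE : #E < κ) (hX : #X < κ) (e : E → M)
    (Φ₀ : Set (Σ n : ℕ, L.Formula (E ⊕ (Fin n × X)))) (hΦ₀ : ∀ p ∈ Φ₀, IsPositive p.2)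
    (s₀ : ℕ → X → M) (hs₀ : EMRealizes e Φ₀ s₀) :
    ∃ s : ℕ → X → M, IndiscernibleOver L e s ∧ EMRealizes e Φ₀ s := by
  classical
  let S : Set (Set (Σ n : ℕ, L.Formula (E ⊕ (Fin n × X)))) :=
    {Φ | (∀ p ∈ Φ, IsPositive p.2) ∧ ∃ s : ℕ → X → M, EMRealizes e Φ s}
  have hchain : ∀ c ⊆ S, IsChain (· ⊆ ·) c → c.Nonempty → ∃ ub ∈ S, ∀ s ∈ c, s ⊆ ub := by
    intro c hc hchain hne
    have hpos : ∀ p ∈ ⋃₀ c, IsPositive p.2 := by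
      rintro p ⟨Φ, hΦ, hp⟩
      exact (hc hΦ).1 p hp
    refine ⟨⋃₀ c, ⟨hpos, ?_⟩, fun s hs => Set.subset_sUnion_of_mem hs⟩
    have : #(ULift.{u} ℕ) < κ := by simpa using h.aleph0_lt
    obtain ⟨s, hs⟩ := h.exists_emRealizes hE hX this e (⋃₀ c) hpos (by
      intro Δ hΔ
      obtain ⟨Φ, hΦ, hΔΦ⟩ := DirectedOn.exists_mem_subset_of_finset_subset_biUnion (f := id) hne
        hchain.directedOn (by rwa [Set.sUnion_eq_biUnion] at hΔ)
      obtain ⟨s, hs⟩ := (hc hΦ).2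
      exact ⟨s, hs.mono hΔΦ⟩)
    exact ⟨fun k => s ⟨k⟩, hs.comp (f := ULift.up) fun a b hab => hab⟩
  -- For a maximal `Φ`, every positive formula either lies in `Φ` or is contradicted by a member of
  -- `Φ`; therefore every sequence realising `Φ` is indiscernible.
  obtain ⟨Φ, hΦ₀Φ, hmax⟩ := zorn_subset_nonempty S hchain Φ₀ ⟨hΦ₀, s₀, hs₀⟩
  have hΦ := hmax.prop
  have key : ∀ (n : ℕ) (χ : L.Formula (E ⊕ (Fin n × X))), IsPositive χ → ⟨n, χ⟩ ∉ Φ →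
      ∃ ψ : L.Formula (E ⊕ (Fin n × X)), ⟨n, ψ⟩ ∈ Φ ∧
        ∀ v : E ⊕ (Fin n × X) → M, ψ.Realize v → ¬ χ.Realize v := by
    intro n χ hχ hχΦ
    let F := L.Formula (E ⊕ (Fin n × X))
    let μ : Cardinal.{u} := max ℵ₀ #(Option F)
    have hμ : μ < κ := by
      refine max_lt h.aleph0_lt ?_
      rw [Cardinal.mk_option]
      exact Cardinal.add_lt_of_lt h.aleph0_lt.le
        (h.mk_formula_lt (h.mk_sum_lt hE (h.mk_countable_prod_lt (Fin n) hX)))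
        (Cardinal.one_lt_aleph0.trans h.aleph0_lt)
    let I := (Order.succ (iterExp μ n)).ord.ToType
    have hI : #I = Order.succ (iterExp μ n) := Cardinal.mk_ord_toType _
    obtain ⟨s, hs⟩ := h.exists_emRealizes (I := I) hE hX
      (by rw [hI]; exact h.succ_lt (h.iterExp_lt hμ n)) e Φ hΦ.1
      (fun Δ hΔ => hΦ.2.imp fun s hs => hs.mono hΔ)
    let v : (Fin n → I) → E ⊕ (Fin n × X) → M := fun i => Sum.elim e fun q => s (i q.1) q.2
    -- The colour of a tuple is `none` if `χ` holds there, and otherwise a positive formula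
    -- witnessing its failure. A constant colour on an infinite subsequence can be added to `Φ`, so
    -- by maximality it is already there. One formula is treated at a time, so an infinite
    -- homogeneous sequence suffices.
    have hcol : ∀ i : Fin n → I, ∃ z : Option F,
        (z = none → χ.Realize (v i)) ∧ ∀ ψ, z = some ψ → IsPositive ψ ∧ ψ.Realize (v i) ∧
          ∀ w : E ⊕ (Fin n × X) → M, ψ.Realize w → ¬ χ.Realize w := by
      intro i
      by_cases hi : χ.Realize (v i)
      · exact ⟨none, fun _ => hi, fun ψ hψ => by cases hψ⟩
      · obtain ⟨ψ, hψ⟩ := h.ec.exists_contradicting hχ hi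
        refine ⟨some ψ, fun h => (Option.some_ne_none _ h).elim, fun ψ' h => ?_⟩
        cases h
        exact hψ
    choose c hc using hcol
    obtain ⟨f, hf, hfc⟩ := erdos_rado (μ := μ) (le_max_left _ _) (le_max_right _ _) n I
      (by rw [hI]; exact Order.lt_succ _) c
    have hext : ∀ θ : F, IsPositive θ → (∀ i : Fin n → ℕ, StrictMono i → θ.Realize (v (f ∘ i))) →
        ⟨n, θ⟩ ∈ Φ := by
      intro θ hθ hθi
      refine hmax.le_of_ge (y := insert ⟨n, θ⟩ Φ) ⟨?_, fun k => s (f k), ?_⟩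
        (Set.subset_insert _ _) (Set.mem_insert _ _)
      · rintro p (rfl | hp)
        · exact hθ
        · exact hΦ.1 p hp
      · rintro p (rfl | hp)
        · exact hθi
        · exact hs.comp hf p hp
    have h0 : StrictMono fun k : Fin n => (k : ℕ) := fun a b hab => hab
    rcases hz : c (f ∘ fun k : Fin n => (k : ℕ)) with _ | ψ
    · exact absurd (hext χ hχ fun i hi => (hc _).1 ((hfc i _ hi h0).trans hz)) hχΦ
    · exact ⟨ψ, hext ψ ((hc _).2 ψ hz).1 fun i hi =>
        ((hc _).2 ψ ((hfc i _ hi h0).trans hz)).2.1, ((hc _).2 ψ hz).2.2⟩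
  obtain ⟨s, hs⟩ := hΦ.2
  refine ⟨s, fun n i j hi hj χ hχ => ?_, hs.mono hΦ₀Φ⟩
  by_cases hχΦ : ⟨n, χ⟩ ∈ Φ
  · exact iff_of_true (hs _ hχΦ i hi) (hs _ hχΦ j hj)
  · obtain ⟨ψ, hψ, hψχ⟩ := key n χ hχ hχΦ
    exact iff_of_false (hψχ _ (hs _ hψ i hi)) (hψχ _ (hs _ hψ j hj))

end Extraction

/-! ### Indiscernibility over a tuple and its type-definability. -/

section IndiscernibleOver

variable {L : FirstOrder.Language.{u, u}} {M : Type u} [L.Structure M]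

theorem IndiscernibleOver.pullback {E X E' X' : Type*} {e : E → M} {s : ℕ → X → M}
    (h : IndiscernibleOver L e s) (g : E' → E) (f : X' → X) :
    IndiscernibleOver L (e ∘ g) (fun k => s k ∘ f) := by
  intro n i j hi hj φ hφ
  have := h n i j hi hj (Formula.relabel (Sum.map g (Prod.map id f)) φ) (hφ.relabel _)
  rw [Formula.realize_relabel, Formula.realize_relabel, Sum.elim_comp_map, Sum.elim_comp_map]
    at this
  exact this

theorem IndiscernibleOver.comp_strictMono {E X : Type*} {e : E → M} {s : ℕ → X → M}
    (h : IndiscernibleOver L e s) {f : ℕ → ℕ} (hf : StrictMono f) :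
    IndiscernibleOver L e (fun k => s (f k)) :=
  fun n i j hi hj φ hφ => h n (fun k => f (i k)) (fun k => f (j k)) (hf.comp hi) (hf.comp hj) φ hφ

theorem IndiscernibleOver.const {E X : Type*} (e : E → M) (a : X → M) :
    IndiscernibleOver L e (fun _ => a) :=
  fun _ _ _ _ _ _ _ => Iff.rfl

theorem IndiscernibleOver.adjoin_params {E X E' : Type*} {e : E → M} {s : ℕ → X → M}
    (h : IndiscernibleOver L e s) (g : E' → E) :
    IndiscernibleOver L e (fun k => Sum.elim (s k) (e ∘ g)) := by
  intro n i j hi hj φ hφ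
  let r : E ⊕ (Fin n × (X ⊕ E')) → E ⊕ (Fin n × X) := Sum.elim Sum.inl fun q =>
    Sum.elim (fun x => Sum.inr (q.1, x)) (fun c => Sum.inl (g c)) q.2
  have hr : ∀ i : Fin n → ℕ, (Sum.elim e fun q : Fin n × X => s (i q.1) q.2) ∘ r =
      Sum.elim e fun q : Fin n × (X ⊕ E') => Sum.elim (s (i q.1)) (e ∘ g) q.2 := by
    intro i
    funext q
    rcases q with c | ⟨k, x | c⟩ <;> rfl
  have := h n i j hi hj (Formula.relabel r φ) (hφ.relabel r)
  rwa [Formula.realize_relabel, Formula.realize_relabel, hr, hr] at this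

theorem IndiscernibleOver.map {E X : Type*} {e : E → M} {s : ℕ → X → M}
    (h : IndiscernibleOver L e s) (f : M ≃[L] M) :
    IndiscernibleOver L (fun c => f (e c)) (fun k x => f (s k x)) := by
  intro n i j hi hj φ hφ
  have key : ∀ i : Fin n → ℕ, (φ.Realize (Sum.elim (fun c => f (e c))
      fun q : Fin n × X => f (s (i q.1) q.2)) ↔
        φ.Realize (Sum.elim e fun q : Fin n × X => s (i q.1) q.2)) := by
    intro i
    rw [← realize_equiv f φ (Sum.elim e fun q : Fin n × X => s (i q.1) q.2)]
    congr! 1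
    funext q
    rcases q with c | q <;> rfl
  rw [key, key]
  exact h n i j hi hj φ hφ

/-- Indiscernibility is a property of finite subtuples. -/
theorem indiscernibleOver_of_finset {E X : Type u} {e : E → M} {s : ℕ → X → M}
    (h : ∀ (E₀ : Finset E) (F : Finset X),
      IndiscernibleOver L (fun c : E₀ => e c) (fun k (x : F) => s k x)) :
    IndiscernibleOver L e s := by
  classical
  intro n i j hi hj φ hφ
  obtain ⟨G, φ', hφ', hG⟩ := hφ.exists_finset
  let E₀ : Finset E := G.biUnion fun p => Sum.elim (fun c => {c}) (fun _ => ∅) p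
  let F : Finset X := G.biUnion fun p => Sum.elim (fun _ => ∅) (fun q => {q.2}) p
  let r : G → E₀ ⊕ (Fin n × F) := fun p => match p with
    | ⟨Sum.inl c, hc⟩ => Sum.inl ⟨c, Finset.mem_biUnion.2 ⟨_, hc, Finset.mem_singleton_self _⟩⟩
    | ⟨Sum.inr q, hq⟩ =>
      Sum.inr (q.1, ⟨q.2, Finset.mem_biUnion.2 ⟨_, hq, Finset.mem_singleton_self _⟩⟩)
  have hr : ∀ i : Fin n → ℕ, (Sum.elim (fun c : E₀ => e c)
      fun q : Fin n × F => s (i q.1) q.2) ∘ r =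
        fun p : G => Sum.elim e (fun q : Fin n × X => s (i q.1) q.2) p := by
    intro i
    funext p
    rcases p with ⟨c | q, hp⟩ <;> rfl
  have := h E₀ F n i j hi hj (Formula.relabel r φ') (hφ'.relabel r)
  rwa [Formula.realize_relabel, Formula.realize_relabel, hr, hr, hG, hG] at this

/-- Repeating `e` in every term trades parameters for coordinates, so that thickness, which concerns
indiscernibility over `∅`, applies over parameters. -/
theorem indiscernible_elim_iff {E X : Type u} (e : E → M) (s : ℕ → X → M) :
    Indiscernible L (∅ : Set M) (fun k => Sum.elim e (s k)) ↔ IndiscernibleOver L e s := by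
  constructor
  · intro h n i j hi hj φ hφ
    -- Reading `e` off a term requires at least one term; for `n = 0` the index tuples coincide.
    rcases n with _ | n
    · rw [Subsingleton.elim i j]
    · let r : E ⊕ (Fin (n + 1) × X) → (∅ : Set M) ⊕ (Fin (n + 1) × (E ⊕ X)) :=
        Sum.elim (fun c => Sum.inr (0, Sum.inl c)) (fun q => Sum.inr (q.1, Sum.inr q.2))
      have hr : ∀ i : Fin (n + 1) → ℕ, Sum.elim (fun c : (∅ : Set M) => (c : M))
          (fun q : Fin (n + 1) × (E ⊕ X) => Sum.elim e (s (i q.1)) q.2) ∘ r =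
            Sum.elim e fun q => s (i q.1) q.2 := by
        intro i
        funext p
        rcases p with c | q <;> rfl
      have := h (n + 1) i j hi hj (Formula.relabel r φ) (hφ.relabel r)
      rwa [Formula.realize_relabel, Formula.realize_relabel, hr, hr] at this
  · intro h n i j hi hj φ hφ
    let r : (∅ : Set M) ⊕ (Fin n × (E ⊕ X)) → E ⊕ (Fin n × X) :=
      Sum.elim (fun c => c.2.elim) fun q =>
        Sum.elim Sum.inl (fun x => Sum.inr (q.1, x)) q.2
    have hr : ∀ i : Fin n → ℕ, Sum.elim e (fun q : Fin n × X => s (i q.1) q.2) ∘ r =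
        Sum.elim (fun c : (∅ : Set M) => (c : M))
          (fun q : Fin n × (E ⊕ X) => Sum.elim e (s (i q.1)) q.2) := by
      intro i
      funext p
      rcases p with c | ⟨k, c | x⟩
      · exact c.2.elim
      · rfl
      · rfl
    have := h n i j hi hj (Formula.relabel r φ) (hφ.relabel r)
    rwa [Formula.realize_relabel, Formula.realize_relabel, hr, hr] at this

variable (L) in
/-- The positive formulas satisfied by all `e`-indiscernible sequences. -/
def indiscernibleType {E : Type*} (X : Type*) (e : E → M) : Set (L.Formula (E ⊕ (ℕ × X))) :=
  {φ | IsPositive φ ∧ ∀ s : ℕ → X → M, IndiscernibleOver L e s →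
    φ.Realize (Sum.elim e fun q => s q.1 q.2)}

theorem IsThick.indiscernibleOver (h : IsThick L M) {E X : Type u} {e : E → M} {s : ℕ → X → M}
    (hs : ∀ φ ∈ indiscernibleType L X e, φ.Realize (Sum.elim e fun q => s q.1 q.2)) :
    IndiscernibleOver L e s := by
  obtain ⟨Θ, hΘ, hΘs⟩ := h (E ⊕ X)
  rw [← indiscernible_elim_iff, ← hΘs]
  intro θ hθ
  let r : ℕ × (E ⊕ X) → E ⊕ (ℕ × X) := fun q =>
    Sum.elim Sum.inl (fun x => Sum.inr (q.1, x)) q.2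
  have hr : ∀ s : ℕ → X → M, (Sum.elim e fun q : ℕ × X => s q.1 q.2) ∘ r =
      fun q => Sum.elim e (s q.1) q.2 := by
    intro s
    funext q
    rcases q with ⟨k, c | x⟩ <;> rfl
  have := hs (Formula.relabel r θ) ⟨(hΘ θ hθ).relabel r, fun s hs => by
    rw [Formula.realize_relabel, hr]
    exact (hΘs _).2 ((indiscernible_elim_iff e s).2 hs) θ hθ⟩
  rwa [Formula.realize_relabel, hr] at this

end IndiscernibleOver

/-! ### Relations between tuples that are determined by finite approximations. -/

section LocalRelations

variable (L : FirstOrder.Language.{u, u}) {M : Type u} [L.Structure M]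

/-- A relation between tuples of the same length, over a tuple of parameters. -/
abbrev TupleRel (M : Type u) := ∀ {E X : Type u}, (E → M) → (X → M) → (X → M) → Prop

/-- The positive formulas over `e` that hold for all pairs related by `R` over `e`. -/
def pairType (R : TupleRel M) {E : Type u} (X : Type u) (e : E → M) :
    Set (L.Formula (E ⊕ (X ⊕ X))) :=
  {φ | IsPositive φ ∧ ∀ a b : X → M, R e a b → φ.Realize (Sum.elim e (Sum.elim a b))}

/-- A relation is local if it is compatible with passing to subtuples, and if it holds as soon as
the positive types of its restrictions to finite subtuples are satisfied. -/
structure IsLocal (κ : Cardinal.{u}) (R : TupleRel M) : Prop where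
  pullback : ∀ {E X E' X' : Type u} {e : E → M} {a b : X → M}, R e a b →
    ∀ (g : E' → E) (f : X' → X), R (e ∘ g) (a ∘ f) (b ∘ f)
  compact : ∀ {E X : Type u}, #E < κ → #X < κ → ∀ {e : E → M} {a b : X → M},
    (∀ (E₀ : Finset E) (F : Finset X), ∀ φ ∈ pairType L R F (fun c : E₀ => e c),
      φ.Realize (Sum.elim (fun c : E₀ => e c)
        (Sum.elim (fun x : F => a x) (fun x : F => b x)))) → R e a b

variable {L} {κ : Cardinal.{u}} {R S : TupleRel M}

theorem IsLocal.relabel_mem_pairType (hR : IsLocal L κ R) {E X E' X' : Type u} {e : E → M}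
    (g : E' → E) (f : X' → X) {φ : L.Formula (E' ⊕ (X' ⊕ X'))}
    (hφ : φ ∈ pairType L R X' (e ∘ g)) :
    Formula.relabel (Sum.map g (Sum.map f f)) φ ∈ pairType L R X e := by
  refine ⟨hφ.1.relabel _, fun a b hab => ?_⟩
  rw [Formula.realize_relabel, Sum.elim_comp_map, Sum.elim_comp_map]
  exact hφ.2 _ _ (hR.pullback hab g f)

theorem IsLocal.of_pairType (hR : IsLocal L κ R) {E X : Type u} (hE : #E < κ) (hX : #X < κ)
    {e : E → M} {a b : X → M}
    (h : ∀ φ ∈ pairType L R X e, φ.Realize (Sum.elim e (Sum.elim a b))) : R e a b := by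
  refine hR.compact hE hX fun E₀ F φ hφ => ?_
  have := h _ (hR.relabel_mem_pairType (Subtype.val : E₀ → E) (Subtype.val : F → X) hφ)
  rw [Formula.realize_relabel, Sum.elim_comp_map, Sum.elim_comp_map] at this
  exact this

theorem IsLocal.of_finset (hR : IsLocal L κ R) {E X : Type u} (hE : #E < κ) (hX : #X < κ)
    {e : E → M} {a b : X → M} (h : ∀ (E₀ : Finset E) (F : Finset X),
      R (fun c : E₀ => e c) (fun x : F => a x) (fun x : F => b x)) : R e a b :=
  hR.compact hE hX fun E₀ F _ hφ => hφ.2 _ _ (h E₀ F)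

/-- Makes the finite approximations directed: both formulas are moved to the union of their supports
and conjoined. -/
theorem IsLocal.exists_common (hR : IsLocal L κ R) {E X : Type u}
    [DecidableEq E] [DecidableEq X] {e : E → M}
    {E₁ E₂ : Finset E} {F₁ F₂ : Finset X} {φ₁ : L.Formula (E₁ ⊕ (F₁ ⊕ F₁))}
    (h₁ : φ₁ ∈ pairType L R F₁ (fun c : E₁ => e c)) {φ₂ : L.Formula (E₂ ⊕ (F₂ ⊕ F₂))}
    (h₂ : φ₂ ∈ pairType L R F₂ (fun c : E₂ => e c)) :
    ∃ φ ∈ pairType L R (F₁ ∪ F₂ : Finset X) (fun c : (E₁ ∪ E₂ : Finset E) => e c),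
      ∀ (e' : E → M) (a b : X → M),
        φ.Realize (Sum.elim (fun c : (E₁ ∪ E₂ : Finset E) => e' c)
          (Sum.elim (fun x : (F₁ ∪ F₂ : Finset X) => a x) (fun x : (F₁ ∪ F₂ : Finset X) => b x))) →
        φ₁.Realize (Sum.elim (fun c : E₁ => e' c)
          (Sum.elim (fun x : F₁ => a x) (fun x : F₁ => b x))) ∧
        φ₂.Realize (Sum.elim (fun c : E₂ => e' c)
          (Sum.elim (fun x : F₂ => a x) (fun x : F₂ => b x))) := by
  let g₁ : E₁ → (E₁ ∪ E₂ : Finset E) := fun c => ⟨c, Finset.mem_union_left _ c.2⟩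
  let f₁ : F₁ → (F₁ ∪ F₂ : Finset X) := fun c => ⟨c, Finset.mem_union_left _ c.2⟩
  let g₂ : E₂ → (E₁ ∪ E₂ : Finset E) := fun c => ⟨c, Finset.mem_union_right _ c.2⟩
  let f₂ : F₂ → (F₁ ∪ F₂ : Finset X) := fun c => ⟨c, Finset.mem_union_right _ c.2⟩
  have k₁ := hR.relabel_mem_pairType (e := fun c : (E₁ ∪ E₂ : Finset E) => e c) g₁ f₁ h₁
  have k₂ := hR.relabel_mem_pairType (e := fun c : (E₁ ∪ E₂ : Finset E) => e c) g₂ f₂ h₂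
  refine ⟨_ ⊓ _, ⟨k₁.1.inf k₂.1, fun a b hab => Formula.realize_inf.2
    ⟨k₁.2 a b hab, k₂.2 a b hab⟩⟩, fun e' a b h => ?_⟩
  rw [Formula.realize_inf, Formula.realize_relabel, Formula.realize_relabel, Sum.elim_comp_map,
    Sum.elim_comp_map, Sum.elim_comp_map, Sum.elim_comp_map] at h
  exact h

theorem isLocal_eq : IsLocal L κ (M := M) (fun _ a b => a = b) where
  pullback := by
    rintro E X E' X' e a b rfl g f
    rfl
  compact := by
    intro E X _ _ e a b h
    funext x
    have := h ∅ {x} (Term.equal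
      (Term.var (Sum.inr (Sum.inl ⟨x, Finset.mem_singleton_self x⟩)))
      (Term.var (Sum.inr (Sum.inr ⟨x, Finset.mem_singleton_self x⟩))))
      ⟨isPositive_termEqual _ _, by
        rintro a b rfl
        simp [Term.equal, Term.bdEqual, Formula.Realize, BoundedFormula.Realize]⟩
    simpa [Term.equal, Term.bdEqual, Formula.Realize, BoundedFormula.Realize] using this

theorem IsLocal.swap (hR : IsLocal L κ R) : IsLocal L κ (M := M) (fun e a b => R e b a) where
  pullback h g f := hR.pullback h g f
  compact := by
    intro E X hE hX e a b h
    refine hR.compact hE hX fun E₀ F φ hφ => ?_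
    have := h E₀ F (Formula.relabel (Sum.map id Sum.swap) φ) ⟨hφ.1.relabel _, fun a b hab => by
      rw [Formula.realize_relabel, Sum.elim_comp_map]
      simpa using hφ.2 _ _ hab⟩
    rw [Formula.realize_relabel, Sum.elim_comp_map] at this
    simpa using this

/-- If both relations fail, so does one approximation of each; on common support their disjunction
is a failing approximation of the union. -/
theorem IsLocal.or (hR : IsLocal L κ R) (hS : IsLocal L κ S) :
    IsLocal L κ (M := M) (fun e a b => R e a b ∨ S e a b) where
  pullback h g f := h.imp (fun h => hR.pullback h g f) (fun h => hS.pullback h g f)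
  compact := by
    classical
    intro E X hE hX e a b h
    by_contra hcon
    rw [not_or] at hcon
    have hR' := mt (hR.compact hE hX (e := e) (a := a) (b := b)) hcon.1
    have hS' := mt (hS.compact hE hX (e := e) (a := a) (b := b)) hcon.2
    push Not at hR' hS'
    obtain ⟨E₁, F₁, φ₁, h₁, hn₁⟩ := hR'
    obtain ⟨E₂, F₂, φ₂, h₂, hn₂⟩ := hS'
    have hR1 : (⊤ : L.Formula (E₂ ⊕ (F₂ ⊕ F₂))) ∈ pairType L R F₂ (fun c : E₂ => e c) :=
      ⟨.verum, fun a b _ => Formula.realize_top.2 trivial⟩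
    have hS1 : (⊤ : L.Formula (E₁ ⊕ (F₁ ⊕ F₁))) ∈ pairType L S F₁ (fun c : E₁ => e c) :=
      ⟨.verum, fun a b _ => Formula.realize_top.2 trivial⟩
    obtain ⟨φ, hφ, hφ'⟩ := hR.exists_common h₁ hR1
    obtain ⟨ψ, hψ, hψ'⟩ := hS.exists_common hS1 h₂
    have := h _ _ (φ ⊔ ψ) ⟨hφ.1.sup hψ.1, fun a b hab => Formula.realize_sup.2
      (hab.imp (hφ.2 a b) (hψ.2 a b))⟩
    rcases Formula.realize_sup.1 this with h | h
    · exact hn₁ (hφ' e a b h).1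
    · exact hn₂ (hψ' e a b h).2

variable {T : L.Theory}

/-- Existence of an intermediate tuple can be checked on finite subtuples and formulas. -/
theorem IsMonster.exists_comp [Nonempty M] (h : IsMonster T κ M) (hR : IsLocal L κ R)
    (hS : IsLocal L κ S) {E X : Type u} (hE : #E < κ) (hX : #X < κ) {e : E → M} {a b : X → M}
    (H : ∀ (E₀ : Finset E) (F : Finset X), ∀ φ ∈ pairType L R F (fun c : E₀ => e c),
      ∀ ψ ∈ pairType L S F (fun c : E₀ => e c), ∃ c : F → M,
        φ.Realize (Sum.elim (fun c : E₀ => e c) (Sum.elim (fun x : F => a x) c)) ∧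
        ψ.Realize (Sum.elim (fun c : E₀ => e c) (Sum.elim c (fun x : F => b x)))) :
    ∃ c : X → M, R e a c ∧ S e c b := by
  classical
  let r₁ : ∀ (E₀ : Finset E) (F : Finset X), E₀ ⊕ (F ⊕ F) → (E ⊕ (X ⊕ X)) ⊕ X := fun E₀ F =>
    Sum.elim (fun c => Sum.inl (Sum.inl c))
      (Sum.elim (fun x => Sum.inl (Sum.inr (Sum.inl x))) (fun x => Sum.inr x))
  let r₂ : ∀ (E₀ : Finset E) (F : Finset X), E₀ ⊕ (F ⊕ F) → (E ⊕ (X ⊕ X)) ⊕ X := fun E₀ F =>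
    Sum.elim (fun c => Sum.inl (Sum.inl c))
      (Sum.elim (fun x => Sum.inr x) (fun x => Sum.inl (Sum.inr (Sum.inr x))))
  have hr₁ : ∀ (e : E → M) (a b z : X → M) (E₀ : Finset E) (F : Finset X),
      Sum.elim (Sum.elim e (Sum.elim a b)) z ∘ r₁ E₀ F = Sum.elim (fun c : E₀ => e c)
        (Sum.elim (fun x : F => a x) (fun x : F => z x)) := by
    intro e a b z E₀ F
    funext p
    rcases p with c | x | x <;> rfl
  have hr₂ : ∀ (e : E → M) (a b z : X → M) (E₀ : Finset E) (F : Finset X),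
      Sum.elim (Sum.elim e (Sum.elim a b)) z ∘ r₂ E₀ F = Sum.elim (fun c : E₀ => e c)
        (Sum.elim (fun x : F => z x) (fun x : F => b x)) := by
    intro e a b z E₀ F
    funext p
    rcases p with c | x | x <;> rfl
  have htop : ∀ {Q : TupleRel M} (E₀ : Finset E) (F : Finset X),
      (⊤ : L.Formula (E₀ ⊕ (F ⊕ F))) ∈ pairType L Q F (fun c : E₀ => e c) :=
    fun _ _ => ⟨.verum, fun _ _ _ => Formula.realize_top.2 trivial⟩
  let Γ : Set (L.Formula ((E ⊕ (X ⊕ X)) ⊕ X)) :=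
    {θ | ∃ (E₀ : Finset E) (F : Finset X) (φ ψ : L.Formula (E₀ ⊕ (F ⊕ F))),
      φ ∈ pairType L R F (fun c : E₀ => e c) ∧ ψ ∈ pairType L S F (fun c : E₀ => e c) ∧
        θ = Formula.relabel (r₁ E₀ F) φ ⊓ Formula.relabel (r₂ E₀ F) ψ}
  obtain ⟨z, hz⟩ := h.saturated.exists_realize_of_directed
    (h.mk_sum_lt hE (h.mk_sum_lt hX hX)) hX (Sum.elim e (Sum.elim a b)) Γ
    (by
      rintro _ ⟨E₀, F, φ, ψ, hφ, hψ, rfl⟩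
      exact (hφ.1.relabel _).inf (hψ.1.relabel _))
    ⟨_, ∅, ∅, ⊤, ⊤, htop _ _, htop _ _, rfl⟩
    (by
      rintro _ ⟨E₁, F₁, φ₁, ψ₁, hφ₁, hψ₁, rfl⟩ _ ⟨E₂, F₂, φ₂, ψ₂, hφ₂, hψ₂, rfl⟩
      obtain ⟨φ, hφ, hφ'⟩ := hR.exists_common hφ₁ hφ₂
      obtain ⟨ψ, hψ, hψ'⟩ := hS.exists_common hψ₁ hψ₂
      refine ⟨_, ⟨_, _, φ, ψ, hφ, hψ, rfl⟩, fun v hv => ?_⟩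
      obtain ⟨e', a', b', z', rfl⟩ : ∃ (e' : E → M) (a' b' z' : X → M),
          v = Sum.elim (Sum.elim e' (Sum.elim a' b')) z' :=
        ⟨fun c => v (Sum.inl (Sum.inl c)), fun x => v (Sum.inl (Sum.inr (Sum.inl x))),
          fun x => v (Sum.inl (Sum.inr (Sum.inr x))), fun x => v (Sum.inr x), by
            funext p
            rcases p with (c | x | x) | x <;> rfl⟩
      simp only [Formula.realize_inf, Formula.realize_relabel, hr₁, hr₂] at hv ⊢
      have h1 := hφ' _ _ _ hv.1
      have h2 := hψ' _ _ _ hv.2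
      exact ⟨⟨h1.1, h2.1⟩, h1.2, h2.2⟩)
    (by
      rintro _ ⟨E₀, F, φ, ψ, hφ, hψ, rfl⟩
      obtain ⟨c, h1, h2⟩ := H E₀ F φ hφ ψ hψ
      let z : X → M := fun x => if hx : x ∈ F then c ⟨x, hx⟩ else Classical.arbitrary M
      have hz : (fun x : F => z x) = c := funext fun x => dif_pos x.2
      refine ⟨z, ?_⟩
      rw [Formula.realize_inf, Formula.realize_relabel, Formula.realize_relabel, hr₁, hr₂, hz]
      exact ⟨h1, h2⟩)
  refine ⟨z, hR.compact hE hX fun E₀ F φ hφ => ?_, hS.compact hE hX fun E₀ F ψ hψ => ?_⟩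
  · have := hz _ ⟨E₀, F, φ, ⊤, hφ, htop _ _, rfl⟩
    rw [Formula.realize_inf, Formula.realize_relabel, hr₁] at this
    exact this.1
  · have := hz _ ⟨E₀, F, ⊤, ψ, htop _ _, hψ, rfl⟩
    rw [Formula.realize_inf, Formula.realize_relabel, Formula.realize_relabel, hr₂] at this
    exact this.2

/-- For approximations `φ` of `R` and `ψ` of `S`, the positive formula `∃ c, φ(a,c) ∧ ψ(c,b)`
approximates the composite; saturation then produces one `c` for all of them. -/
theorem IsMonster.isLocal_comp [Nonempty M] (h : IsMonster T κ M) (hR : IsLocal L κ R)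
    (hS : IsLocal L κ S) :
    IsLocal L κ (M := M) (fun e a b => ∃ c, R e a c ∧ S e c b) where
  pullback := by
    rintro E X E' X' e a b ⟨c, h1, h2⟩ g f
    exact ⟨c ∘ f, hR.pullback h1 g f, hS.pullback h2 g f⟩
  compact := by
    intro E X hE hX e a b H
    refine h.exists_comp hR hS hE hX fun E₀ F φ hφ ψ hψ => ?_
    let r₁ : E₀ ⊕ (F ⊕ F) → (E₀ ⊕ (F ⊕ F)) ⊕ F :=
      Sum.elim (fun c => Sum.inl (Sum.inl c))
        (Sum.elim (fun x => Sum.inl (Sum.inr (Sum.inl x))) (fun x => Sum.inr x))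
    let r₂ : E₀ ⊕ (F ⊕ F) → (E₀ ⊕ (F ⊕ F)) ⊕ F :=
      Sum.elim (fun c => Sum.inl (Sum.inl c))
        (Sum.elim (fun x => Sum.inr x) (fun x => Sum.inl (Sum.inr (Sum.inr x))))
    have hr₁ : ∀ (e : E₀ → M) (a b z : F → M),
        Sum.elim (Sum.elim e (Sum.elim a b)) z ∘ r₁ = Sum.elim e (Sum.elim a z) := by
      intro e a b z
      funext p
      rcases p with c | x | x <;> rfl
    have hr₂ : ∀ (e : E₀ → M) (a b z : F → M),
        Sum.elim (Sum.elim e (Sum.elim a b)) z ∘ r₂ = Sum.elim e (Sum.elim z b) := by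
      intro e a b z
      funext p
      rcases p with c | x | x <;> rfl
    obtain ⟨χ, hχ, hχ'⟩ := ((hφ.1.relabel r₁).inf (hψ.1.relabel r₂)).exists_projection
    have := H E₀ F χ ⟨hχ, fun a b hab => by
      obtain ⟨c, h1, h2⟩ := hab
      rw [hχ']
      refine ⟨c, ?_⟩
      rw [Formula.realize_inf, Formula.realize_relabel, Formula.realize_relabel, hr₁, hr₂]
      exact ⟨hφ.2 _ _ h1, hψ.2 _ _ h2⟩⟩
    rw [hχ'] at this
    obtain ⟨c, hc⟩ := this
    rw [Formula.realize_inf, Formula.realize_relabel, Formula.realize_relabel, hr₁, hr₂] at hc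
    exact ⟨c, hc⟩

variable (L) in
/-- `a`, `b` are the first two terms of an `e`-indiscernible sequence. -/
def StartsIndiscernible {E X : Type*} (e : E → M) (a b : X → M) : Prop :=
  ∃ s : ℕ → X → M, IndiscernibleOver L e s ∧ s 0 = a ∧ s 1 = b

/-- The sequence `a, b, z 0, z 1, …`. -/
def consTwo {X : Type*} (a b : X → M) (z : ℕ × X → M) : ℕ → X → M
  | 0 => a
  | 1 => b
  | k + 2 => fun x => z (k, x)

/-- The only use of thickness: a tail of the sequence is found by saturation, and the formulas it
satisfies on finite subtuples force indiscernibility. -/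
theorem IsMonster.isLocal_startsIndiscernible [Nonempty M] (h : IsMonster T κ M)
    (hthick : IsThick L M) :
    IsLocal L κ (M := M) (fun e a b => StartsIndiscernible L e a b) where
  pullback := by
    rintro E X E' X' e a b ⟨s, hs, rfl, rfl⟩ g f
    exact ⟨_, hs.pullback g f, rfl, rfl⟩
  compact := by
    classical
    intro E X hE hX e a b H
    let r : ∀ (E X : Type u), E ⊕ (ℕ × X) → (E ⊕ (X ⊕ X)) ⊕ (ℕ × X) := fun E X =>
      Sum.elim (fun c => Sum.inl (Sum.inl c)) fun q => match q with
        | (0, x) => Sum.inl (Sum.inr (Sum.inl x))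
        | (1, x) => Sum.inl (Sum.inr (Sum.inr x))
        | (k + 2, x) => Sum.inr (k, x)
    have hr : ∀ {E X : Type u} (e : E → M) (a b : X → M) (z : ℕ × X → M),
        Sum.elim (Sum.elim e (Sum.elim a b)) z ∘ r E X =
          Sum.elim e fun q => consTwo a b z q.1 q.2 := by
      intro E X e a b z
      funext p
      rcases p with c | ⟨_ | _ | k, x⟩ <;> rfl
    let ι : ∀ (E₀ : Finset E) (F : Finset X), E₀ ⊕ (ℕ × F) → E ⊕ (ℕ × X) := fun E₀ F =>
      Sum.map Subtype.val (Prod.map id Subtype.val)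
    have hmono : ∀ {E₁ E₂ : Finset E} {F₁ F₂ : Finset X} (hE : E₁ ⊆ E₂) (hF : F₁ ⊆ F₂)
        (φ : L.Formula (E₁ ⊕ (ℕ × F₁))), φ ∈ indiscernibleType L F₁ (fun c : E₁ => e c) →
        ∃ ψ ∈ indiscernibleType L F₂ (fun c : E₂ => e c), ∀ v : E ⊕ (ℕ × X) → M,
          ψ.Realize (v ∘ ι E₂ F₂) → φ.Realize (v ∘ ι E₁ F₁) := by
      intro E₁ E₂ F₁ F₂ hE hF φ hφ
      let g : E₁ → E₂ := fun c => ⟨c, hE c.2⟩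
      let f : F₁ → F₂ := fun x => ⟨x, hF x.2⟩
      refine ⟨Formula.relabel (Sum.map g (Prod.map id f)) φ, ⟨hφ.1.relabel _, fun s hs => ?_⟩,
        fun v hv => ?_⟩
      · rw [Formula.realize_relabel, Sum.elim_comp_map]
        exact hφ.2 _ (hs.pullback g f)
      · rw [Formula.realize_relabel] at hv
        convert hv using 1
        funext p
        rcases p with c | q <;> rfl
    let Γ : Set (L.Formula ((E ⊕ (X ⊕ X)) ⊕ (ℕ × X))) :=
      {θ | ∃ (E₀ : Finset E) (F : Finset X) (φ : L.Formula (E₀ ⊕ (ℕ × F))),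
        φ ∈ indiscernibleType L F (fun c : E₀ => e c) ∧
          θ = Formula.relabel (r E X ∘ ι E₀ F) φ}
    obtain ⟨z, hz⟩ := h.saturated.exists_realize_of_directed
      (h.mk_sum_lt hE (h.mk_sum_lt hX hX)) (h.mk_countable_prod_lt ℕ hX)
      (Sum.elim e (Sum.elim a b)) Γ
      (by
        rintro _ ⟨E₀, F, φ, hφ, rfl⟩
        exact hφ.1.relabel _)
      ⟨_, ∅, ∅, ⊤, ⟨.verum, fun _ _ => Formula.realize_top.2 trivial⟩, rfl⟩
      (by
        rintro _ ⟨E₁, F₁, φ₁, hφ₁, rfl⟩ _ ⟨E₂, F₂, φ₂, hφ₂, rfl⟩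
        obtain ⟨ψ₁, hψ₁, h₁⟩ := hmono (E₂ := E₁ ∪ E₂) (F₂ := F₁ ∪ F₂)
          Finset.subset_union_left Finset.subset_union_left φ₁ hφ₁
        obtain ⟨ψ₂, hψ₂, h₂⟩ := hmono (E₂ := E₁ ∪ E₂) (F₂ := F₁ ∪ F₂)
          Finset.subset_union_right Finset.subset_union_right φ₂ hφ₂
        refine ⟨_, ⟨_, _, ψ₁ ⊓ ψ₂, ⟨hψ₁.1.inf hψ₂.1, fun s hs => Formula.realize_inf.2
          ⟨hψ₁.2 s hs, hψ₂.2 s hs⟩⟩, rfl⟩, fun v hv => ?_⟩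
        rw [Formula.realize_relabel, ← Function.comp_assoc, Formula.realize_inf] at hv
        rw [Formula.realize_relabel, Formula.realize_relabel, ← Function.comp_assoc,
          ← Function.comp_assoc]
        exact ⟨h₁ _ hv.1, h₂ _ hv.2⟩)
      (by
        rintro _ ⟨E₀, F, φ, hφ, rfl⟩
        -- Quantifying out the terms after the first two yields an approximation in `a`, `b` alone.
        obtain ⟨χ, hχ, hχ'⟩ := (hφ.1.relabel (r E₀ F)).exists_projection
        have := H E₀ F χ ⟨hχ, fun a b hab => by
          obtain ⟨s, hs, rfl, rfl⟩ := hab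
          rw [hχ']
          refine ⟨fun q => s (q.1 + 2) q.2, ?_⟩
          rw [Formula.realize_relabel, hr]
          convert hφ.2 s hs using 3 with q
          rcases q with ⟨_ | _ | k, x⟩ <;> rfl⟩
        obtain ⟨c, hc⟩ := (hχ' _ _).1 this
        rw [Formula.realize_relabel, hr] at hc
        refine ⟨fun q => if hx : q.2 ∈ F then c (q.1, ⟨q.2, hx⟩) else Classical.arbitrary M, ?_⟩
        rw [Formula.realize_relabel, ← Function.comp_assoc, hr]
        convert hc using 1
        funext p
        rcases p with c | ⟨_ | _ | k, x⟩
        · rfl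
        · rfl
        · rfl
        · exact dif_pos x.2)
    refine ⟨consTwo a b z, indiscernibleOver_of_finset fun E₀ F =>
      hthick.indiscernibleOver fun φ hφ => ?_, rfl, rfl⟩
    have := hz _ ⟨E₀, F, φ, hφ, rfl⟩
    rw [Formula.realize_relabel, ← Function.comp_assoc, hr] at this
    convert this using 1
    funext p
    rcases p with c | q <;> rfl

end LocalRelations

/-! ### Lascar distance over a tuple of parameters. -/

section Distance

variable {L : FirstOrder.Language.{u, u}} {M : Type u} [L.Structure M]

variable (L) in
/-- `d_e(a, b) ≤ n`, for a tuple of parameters `e`. -/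
def DistOver {E X : Type*} (n : ℕ) (e : E → M) (a b : X → M) : Prop :=
  ∃ c : ℕ → X → M, c 0 = a ∧ c n = b ∧
    ∀ m < n, ∃ (s : ℕ → X → M) (i j : ℕ), IndiscernibleOver L e s ∧ s i = c m ∧ s j = c (m + 1)

theorem distLE_iff_distOver {C : Set M} {n : ℕ} {X : Type*} {a b : X → M} :
    DistLE L C n a b ↔ DistOver L n (Subtype.val : C → M) a b := Iff.rfl

theorem distOver_zero {E X : Type*} {e : E → M} {a b : X → M} : DistOver L 0 e a b ↔ a = b :=
  ⟨fun ⟨_, h0, hn, _⟩ => h0.symm.trans hn, fun h => ⟨fun _ => a, rfl, h, by simp⟩⟩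

theorem DistOver.pullback {E X E' X' : Type*} {n : ℕ} {e : E → M} {a b : X → M}
    (h : DistOver L n e a b) (g : E' → E) (f : X' → X) :
    DistOver L n (e ∘ g) (a ∘ f) (b ∘ f) := by
  obtain ⟨c, rfl, rfl, hc⟩ := h
  refine ⟨fun k => c k ∘ f, rfl, rfl, fun m hm => ?_⟩
  obtain ⟨s, i, j, hs, hi, hj⟩ := hc m hm
  exact ⟨_, i, j, hs.pullback g f, congrArg (· ∘ f) hi, congrArg (· ∘ f) hj⟩

theorem DistOver.map {E X : Type*} {n : ℕ} {e : E → M} {a b : X → M}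
    (h : DistOver L n e a b) (f : M ≃[L] M) :
    DistOver L n (fun c => f (e c)) (fun x => f (a x)) (fun x => f (b x)) := by
  obtain ⟨c, rfl, rfl, hc⟩ := h
  refine ⟨fun k x => f (c k x), rfl, rfl, fun m hm => ?_⟩
  obtain ⟨s, i, j, hs, hi, hj⟩ := hc m hm
  exact ⟨_, i, j, hs.map f, by rw [hi], by rw [hj]⟩

theorem DistOver.adjoin_params {E X E' : Type*} {n : ℕ} {e : E → M} {a b : X → M}
    (h : DistOver L n e a b) (g : E' → E) :
    DistOver L n e (Sum.elim a (e ∘ g)) (Sum.elim b (e ∘ g)) := by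
  obtain ⟨c, rfl, rfl, hc⟩ := h
  refine ⟨fun k => Sum.elim (c k) (e ∘ g), rfl, rfl, fun m hm => ?_⟩
  obtain ⟨s, i, j, hs, hi, hj⟩ := hc m hm
  exact ⟨_, i, j, hs.adjoin_params g, by rw [hi], by rw [hj]⟩

theorem DistOver.trans {E X : Type*} {m n : ℕ} {e : E → M} {a b d : X → M}
    (h₁ : DistOver L m e a b) (h₂ : DistOver L n e b d) : DistOver L (m + n) e a d := by
  obtain ⟨c₁, rfl, h, hc₁⟩ := h₁
  obtain ⟨c₂, rfl, rfl, hc₂⟩ := h₂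
  refine ⟨fun k => if k ≤ m then c₁ k else c₂ (k - m), by simp, ?_, fun k hk => ?_⟩
  · rcases n with _ | n
    · simpa using h
    · simp
  · rcases lt_or_ge k m with hkm | hkm
    · simpa [hkm.le, Nat.succ_le_of_lt hkm] using hc₁ k hkm
    · obtain ⟨l, rfl⟩ := Nat.exists_eq_add_of_le hkm
      have h1 : (if m + l ≤ m then c₁ (m + l) else c₂ (m + l - m)) = c₂ l := by
        split_ifs with h'
        · have : l = 0 := by omega
          subst this
          exact h
        · simp
      have h2 : (if m + l + 1 ≤ m then c₁ (m + l + 1) else c₂ (m + l + 1 - m)) = c₂ (l + 1) := by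
        rw [if_neg (by omega)]
        congr 1
        omega
      simp only [h1, h2]
      exact hc₂ l (by omega)

theorem distOver_succ {E X : Type*} {n : ℕ} {e : E → M} {a b : X → M} :
    DistOver L (n + 1) e a b ↔ ∃ c, DistOver L n e a c ∧ DistOver L 1 e c b := by
  constructor
  · rintro ⟨c, rfl, rfl, hc⟩
    refine ⟨c n, ⟨c, rfl, rfl, fun m hm => hc m (by omega)⟩, fun k => c (n + k), rfl, rfl, ?_⟩
    intro m hm
    exact hc (n + m) (by omega)
  · rintro ⟨c, h1, h2⟩
    exact h1.trans h2

theorem startsIndiscernible_of_lt {E X : Type*} {e : E → M} {s : ℕ → X → M}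
    (hs : IndiscernibleOver L e s) {i j : ℕ} (hij : i < j) :
    StartsIndiscernible L e (s i) (s j) := by
  -- The index sequence is `i, j, j + 1, …`.
  refine ⟨fun k => s (if k = 0 then i else j + k - 1), hs.comp_strictMono
    (f := fun k => if k = 0 then i else j + k - 1) ?_, by simp, by simp⟩
  refine strictMono_nat_of_lt_succ fun k => ?_
  change (if k = 0 then i else j + k - 1) < (if k + 1 = 0 then i else j + (k + 1) - 1)
  rw [if_neg k.succ_ne_zero]
  split_ifs <;> omega

theorem StartsIndiscernible.distOver {E X : Type*} {e : E → M} {a b : X → M}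
    (h : StartsIndiscernible L e a b) : DistOver L 1 e a b := by
  obtain ⟨s, hs, rfl, rfl⟩ := h
  refine ⟨s, rfl, rfl, fun m hm => ⟨s, m, m + 1, hs, rfl, rfl⟩⟩

theorem StartsIndiscernible.distOver_symm {E X : Type*} {e : E → M} {a b : X → M}
    (h : StartsIndiscernible L e a b) : DistOver L 1 e b a := by
  obtain ⟨s, hs, rfl, rfl⟩ := h
  refine ⟨fun k => s (1 - k), rfl, rfl, fun m hm => ⟨s, 1, 0, hs, ?_, ?_⟩⟩ <;>
  · obtain rfl : m = 0 := by omega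
    rfl

/-- Reindexing puts two distinct positions first, but cannot reverse their order, hence the
disjunction; equal positions are covered by a constant sequence. -/
theorem distOver_one_iff {E X : Type*} {e : E → M} {a b : X → M} :
    DistOver L 1 e a b ↔ StartsIndiscernible L e a b ∨ StartsIndiscernible L e b a := by
  constructor
  · rintro ⟨c, rfl, rfl, hc⟩
    obtain ⟨s, i, j, hs, hi, hj⟩ := hc 0 one_pos
    rw [← hi, ← hj]
    rcases lt_trichotomy i j with h | rfl | h
    · exact Or.inl (startsIndiscernible_of_lt hs h)
    · exact Or.inl ⟨_, .const e (s i), rfl, rfl⟩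
    · exact Or.inr (startsIndiscernible_of_lt hs h)
  · rintro (h | h)
    · exact h.distOver
    · exact h.distOver_symm

theorem DistOver.realize_iff {E X : Type*} {n : ℕ} {e : E → M} {a b : X → M}
    (h : DistOver L n e a b) {φ : L.Formula (E ⊕ X)} (hφ : IsPositive φ) :
    φ.Realize (Sum.elim e a) ↔ φ.Realize (Sum.elim e b) := by
  induction n generalizing b with
  | zero => rw [distOver_zero.1 h]
  | succ n ih =>
    obtain ⟨c, h1, d, rfl, rfl, hd⟩ := distOver_succ.1 h
    obtain ⟨s, i, j, hs, hi, hj⟩ := hd 0 one_pos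
    rw [ih h1, ← hi, ← hj]
    have := hs 1 (fun _ => i) (fun _ => j) (Subsingleton.strictMono _) (Subsingleton.strictMono _)
      (Formula.relabel (Sum.map id fun x => (0, x)) φ) (hφ.relabel _)
    rwa [Formula.realize_relabel, Formula.realize_relabel, Sum.elim_comp_map,
      Sum.elim_comp_map] at this

/-- Distance `n` is an iterated composite of distance one, itself a union of a local relation and
its converse. -/
theorem IsMonster.isLocal_distOver [Nonempty M] {T : L.Theory} {κ : Cardinal.{u}}
    (h : IsMonster T κ M) (hthick : IsThick L M) (n : ℕ) :
    IsLocal L κ (M := M) (fun e a b => DistOver L n e a b) := by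
  induction n with
  | zero =>
    simp only [distOver_zero]
    exact isLocal_eq
  | succ n ih =>
    have h1 : IsLocal L κ (M := M) (fun e a b => DistOver L 1 e a b) := by
      simp only [distOver_one_iff]
      exact (h.isLocal_startsIndiscernible hthick).or (h.isLocal_startsIndiscernible hthick).swap
    have := h.isLocal_comp ih h1
    simp only [← distOver_succ] at this
    exact this

end Distance

/-! ### Small sets over which equality of types bounds the distance. -/

section SmallSaturatedSets

variable {L : FirstOrder.Language.{u, u}} {M : Type u} [L.Structure M] {T : L.Theory}
  {κ : Cardinal.{u}}

variable (L) in
/-- All positive types of finite tuples over at most `ν` elements of `A` are realised in `A`. -/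
def RealizesFiniteTypes (ν : Cardinal.{u}) (A : Set M) : Prop :=
  ∀ B : Set M, B ⊆ A → #B ≤ ν → ∀ (F : Type u) [Finite F] (a : F → M),
    ∃ a' : F → M, (∀ x, a' x ∈ A) ∧ SameType L B a a'

theorem IsEC.exists_realizesFiniteTypes [Nonempty M] (hM : IsEC T M) {ν μ : Cardinal.{u}}
    (hν : theoryCard L ≤ ν) (hμ : 2 ^ ν ≤ μ) (hμν : μ ^ ν ≤ μ) (C : Set M) (hC : #C ≤ μ) :
    ∃ A : Set M, C ⊆ A ∧ #A ≤ μ ∧ RealizesFiniteTypes L ν A := by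
  classical
  have hν0 : ℵ₀ ≤ ν := aleph0_le_theoryCard.trans hν
  have hμ0 : ℵ₀ ≤ μ := (hν0.trans (Cardinal.cantor ν).le).trans hμ
  obtain ⟨a₀⟩ := ‹Nonempty M›
  let W : Type u := ν.out
  have hW : #W = ν := Cardinal.mk_out ν
  -- An operation is a set of formulas together with a coordinate; it returns that coordinate of a
  -- chosen solution. Countably many variables accommodate every finite tuple.
  let O : Type u := Set (L.Formula (W ⊕ ULift.{u} ℕ)) × ULift.{u} ℕ
  let f : O → (W → M) → M := fun o t =>
    if h : ∃ a : ULift.{u} ℕ → M, ∀ φ ∈ o.1, φ.Realize (Sum.elim t a) then h.choose o.2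
    else a₀
  have hO : #O ≤ μ := by
    have hF : #(L.Formula (W ⊕ ULift.{u} ℕ)) ≤ ν := by
      refine (mk_formula_le _).trans (max_le ?_ hν)
      rw [Cardinal.mk_sum, Cardinal.lift_id, Cardinal.lift_id, hW, Cardinal.mk_uLift,
        Cardinal.mk_nat, Cardinal.lift_aleph0]
      exact Cardinal.add_le_of_le hν0 le_rfl hν0
    rw [Cardinal.mk_prod, Cardinal.lift_id, Cardinal.lift_id, Cardinal.mk_set, Cardinal.mk_uLift,
      Cardinal.mk_nat, Cardinal.lift_aleph0]
    exact Cardinal.mul_le_of_le hμ0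
      ((Cardinal.power_le_power_left two_ne_zero hF).trans hμ) hμ0
  obtain ⟨A, hCA, hA, hcl⟩ := exists_closed_set f (insert a₀ C) hμ0
    (Cardinal.mk_insert_le.trans (Cardinal.add_le_of_le hμ0 hC (Cardinal.one_le_aleph0.trans hμ0)))
    hO (by rwa [hW])
  refine ⟨A, (Set.subset_insert _ _).trans hCA, hA, fun B hBA hB F _ a => ?_⟩
  have : Nonempty W := Cardinal.mk_ne_zero_iff.1 (by
    rw [hW]; exact (Cardinal.aleph0_pos.trans_le hν0).ne')
  have ha₀ : a₀ ∈ A := hCA (Set.mem_insert _ _)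
  have hB' : #(insert a₀ B : Set M) ≤ #W := by
    rw [hW]
    exact Cardinal.mk_insert_le.trans ((add_le_add hB
      (Cardinal.one_le_aleph0.trans hν0)).trans_eq (Cardinal.add_eq_self hν0))
  have : Nonempty (insert a₀ B : Set M) := ⟨⟨a₀, Set.mem_insert _ _⟩⟩
  obtain ⟨t, ht⟩ := exists_surjective_of_mk_le hB'
  obtain ⟨ι, hι⟩ : ∃ ι : F → ULift.{u} ℕ, Function.Injective ι := by
    obtain ⟨k, ⟨g⟩⟩ := Finite.exists_equiv_fin F
    exact ⟨fun x => ⟨g x⟩, fun x y h => g.injective (Fin.ext (congrArg ULift.down h))⟩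
  let t' : W → M := fun w => t w
  have htA : ∀ w, t' w ∈ A := fun w => (t w).2.elim (fun h => by
    change (t w : M) ∈ A
    rw [h]; exact ha₀) fun h => hBA h
  let a₁ : ULift.{u} ℕ → M := Function.extend ι a fun _ => a₀
  let p : Set (L.Formula (W ⊕ ULift.{u} ℕ)) := {φ | IsPositive φ ∧ φ.Realize (Sum.elim t' a₁)}
  have hex : ∃ a : ULift.{u} ℕ → M, ∀ φ ∈ p, φ.Realize (Sum.elim t' a) :=
    ⟨a₁, fun φ hφ => hφ.2⟩
  have hf : ∀ l, f (p, l) t' = hex.choose l := fun l => dif_pos hex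
  refine ⟨fun x => f (p, ι x) t', fun x => hcl _ _ htA, fun φ hφ =>
    hM.realize_iff_of_imp (fun φ hφ h => ?_) hφ⟩
  choose w hw using fun b : B => ht ⟨b, Set.mem_insert_of_mem _ b.2⟩
  have htw : ∀ b : B, t' (w b) = b := fun b => congrArg Subtype.val (hw b)
  have := hex.choose_spec (Formula.relabel (Sum.map w ι) φ) ⟨hφ.relabel _, by
    rw [Formula.realize_relabel, Sum.elim_comp_map]
    convert h using 2
    · exact funext htw
    · exact funext fun x => hι.extend_apply a (fun _ => a₀) x⟩
  rw [Formula.realize_relabel, Sum.elim_comp_map] at this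
  convert this using 2
  · exact funext fun b => (htw b).symm
  · exact funext fun x => hf _

theorem RealizesFiniteTypes.image {ν : Cardinal.{u}} {A : Set M}
    (h : RealizesFiniteTypes L ν A) (f : M ≃[L] M) : RealizesFiniteTypes L ν (f '' A) := by
  intro B hB hBν F _ a
  obtain ⟨a', ha', hs⟩ := h (f.symm '' B) (by
      rintro _ ⟨b, hb, rfl⟩
      obtain ⟨c, hc, rfl⟩ := hB hb
      simpa using hc) (Cardinal.mk_image_le.trans hBν) F (fun x => f.symm (a x))
  refine ⟨fun x => f (a' x), fun x => ⟨_, ha' x, rfl⟩, fun φ hφ => ?_⟩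
  let g : B → f.symm '' B := fun b => ⟨f.symm b, b, b.2, rfl⟩
  have := hs (Formula.relabel (Sum.map g id) φ) (hφ.relabel _)
  rw [Formula.realize_relabel, Formula.realize_relabel, Sum.elim_comp_map, Sum.elim_comp_map,
    ← realize_equiv f, ← realize_equiv f φ (Sum.elim _ (a' ∘ id))] at this
  convert this using 2
  · funext p
    rcases p with b | x <;> simp [g]
  · funext p
    rcases p with b | x <;> simp [g]

/-- Tuples with the same type over a set realising all small types of finite tuples are at distance
at most two over it. -/
theorem IsMonster.distOver_two_of_sameType [Nonempty M] (h : IsMonster T κ M)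
    (hthick : IsThick L M) {A : Set M} (hAκ : #A < κ)
    (hA : RealizesFiniteTypes L (2 ^ theoryCard L) A) {X : Type u} (hX : #X < κ) {a b : X → M}
    (hab : SameType L A a b) : DistOver L 2 (Subtype.val : A → M) a b := by
  classical
  have hloc := h.isLocal_startsIndiscernible hthick
  suffices H : ∃ c : X → M, StartsIndiscernible L (Subtype.val : A → M) c a ∧
      StartsIndiscernible L (Subtype.val : A → M) c b by
    obtain ⟨c, h1, h2⟩ := H
    exact h1.distOver_symm.trans h2.distOver
  refine h.exists_comp hloc.swap hloc hAκ hX fun E₀ F φ hφ ψ hψ => ?_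
  let e : E₀ → M := fun c => (c : A)
  let aF : F → M := fun x => a x
  let χ : L.Formula (E₀ ⊕ (F ⊕ F)) := Formula.relabel (Sum.map id Sum.swap) φ ⊓ ψ
  have hχ : IsPositive χ := (hφ.1.relabel _).inf hψ.1
  have hχr : ∀ c d : F → M, χ.Realize (Sum.elim e (Sum.elim c d)) ↔
      φ.Realize (Sum.elim e (Sum.elim d c)) ∧ ψ.Realize (Sum.elim e (Sum.elim c d)) := by
    intro c d
    rw [Formula.realize_inf, Formula.realize_relabel, Sum.elim_comp_map]
    simp
  have hχs : ∀ c d : F → M, StartsIndiscernible L e c d →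
      χ.Realize (Sum.elim e (Sum.elim c d)) :=
    fun c d hcd => (hχr c d).2 ⟨hφ.2 _ _ hcd, hψ.2 _ _ hcd⟩
  -- With `c` taken in `A`, `χ(c, ·)` is a formula over `A` and so transfers from `a` to `b`: the
  -- same `c` approximates both links.
  suffices H : ∃ c : F → A, χ.Realize (Sum.elim e (Sum.elim (fun x => (c x : M)) aF)) by
    obtain ⟨c, hc⟩ := H
    have hcb : χ.Realize (Sum.elim e (Sum.elim (fun x => (c x : M)) fun x : F => b x)) := by
      let r : E₀ ⊕ (F ⊕ F) → A ⊕ X :=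
        Sum.elim (fun i => Sum.inl i) (Sum.elim (fun x => Sum.inl (c x)) fun x => Sum.inr x)
      have hr : ∀ d : X → M, Sum.elim (fun c : A => (c : M)) d ∘ r =
          Sum.elim e (Sum.elim (fun x => (c x : M)) fun x : F => d x) := by
        intro d
        funext p
        rcases p with i | x | x <;> rfl
      have := hab (Formula.relabel r χ) (hχ.relabel r)
      rw [Formula.realize_relabel, Formula.realize_relabel, hr, hr] at this
      exact this.1 hc
    exact ⟨fun x => c x, ((hχr _ _).1 hc).1, ((hχr _ _).1 hcb).2⟩
  by_contra hcon
  push Not at hcon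
  set ν : Cardinal.{u} := 2 ^ theoryCard L
  have hν0 : ℵ₀ ≤ ν := aleph0_le_theoryCard.trans (Cardinal.cantor _).le
  let I := (Order.succ ν).ord.ToType
  -- Each term realises the type of `aF` over `e` and all earlier terms; fewer than `ν⁺` parameters
  -- are involved at each stage.
  obtain ⟨f, hf⟩ := exists_wf_sequence (I := I) (V := F → A)
    (fun i g v => SameType L (Set.range e ∪ Set.range fun q : Set.Iio i × F =>
      (g q.1.1 q.1.2 q.2 : M)) aF (fun x => (v x : M))) (by
    intro i g
    have hcard : #(Set.range e ∪ Set.range fun q : Set.Iio i × F =>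
        (g q.1.1 q.1.2 q.2 : M) : Set M) ≤ ν := by
      refine (Cardinal.mk_union_le _ _).trans (Cardinal.add_le_of_le hν0 ?_ ?_)
      · exact Cardinal.mk_range_le.trans ((Cardinal.lt_aleph0_of_finite _).le.trans hν0)
      · refine Cardinal.mk_range_le.trans ?_
        rw [Cardinal.mk_prod, Cardinal.lift_id, Cardinal.lift_id]
        exact Cardinal.mul_le_of_le hν0 (mk_Iio_succ_ord_le i)
          ((Cardinal.lt_aleph0_of_finite _).le.trans hν0)
    obtain ⟨a', ha', hs⟩ := hA _ (by
      rintro x (⟨c, rfl⟩ | ⟨q, rfl⟩)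
      · exact (c : A).2
      · exact (g q.1.1 q.1.2 q.2).2) hcard F aF
    exact ⟨fun x => ⟨a' x, ha' x⟩, hs⟩)
  choose ψ' hψ' hψa hψχ using fun i => h.ec.exists_contradicting hχ (hcon (f i))
  -- Arity one, so a pigeonhole: infinitely many terms share one formula `ψ'` refuting `χ(f i, aF)`.
  -- Later terms imitate `aF` over earlier ones, so `ψ'` holds on increasing pairs.
  obtain ⟨g, hg, hgc⟩ := erdos_rado (μ := theoryCard L) aleph0_le_theoryCard
    ((mk_formula_le _).trans (max_le ((Cardinal.lt_aleph0_of_finite _).le.trans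
      aleph0_le_theoryCard) le_rfl)) 1 I
    (by
      rw [Cardinal.mk_ord_toType]
      exact Order.lt_succ _) (fun i => ψ' (i 0))
  have hgψ : ∀ k, ψ' (g k) = ψ' (g 0) := fun k =>
    hgc (fun _ => k) (fun _ => 0) (Subsingleton.strictMono _) (Subsingleton.strictMono _)
  have hpair : ∀ k l, k < l → (ψ' (g 0)).Realize
      (Sum.elim e (Sum.elim (fun x => (f (g k) x : M)) (fun x => (f (g l) x : M)))) := by
    intro k l hkl
    let B : Set M := Set.range e ∪ Set.range fun q : Set.Iio (g l) × F => (f q.1.1 q.2 : M)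
    let r : E₀ ⊕ (F ⊕ F) → B ⊕ F :=
      Sum.elim (fun i => Sum.inl ⟨e i, Or.inl ⟨i, rfl⟩⟩)
        (Sum.elim (fun x => Sum.inl ⟨f (g k) x, Or.inr ⟨(⟨g k, hg hkl⟩, x), rfl⟩⟩) Sum.inr)
    have hr : ∀ d : F → M, Sum.elim (fun c : B => (c : M)) d ∘ r =
        Sum.elim e (Sum.elim (fun x => (f (g k) x : M)) d) := by
      intro d
      funext p
      rcases p with i | x | x <;> rfl
    have := hf (g l) (Formula.relabel r (ψ' (g 0))) ((hψ' _).relabel r)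
    rw [Formula.realize_relabel, Formula.realize_relabel] at this
    erw [hr, hr] at this
    refine this.1 ?_
    rw [← hgψ k]
    exact hψa (g k)
  let r : E₀ ⊕ (F ⊕ F) → E₀ ⊕ (Fin 2 × F) :=
    Sum.map id (Sum.elim (fun x => (0, x)) (fun x => (1, x)))
  have hr : ∀ (s : ℕ → F → M) (i : Fin 2 → ℕ), Sum.elim e (fun q : Fin 2 × F => s (i q.1) q.2) ∘ r =
      Sum.elim e (Sum.elim (s (i 0)) (s (i 1))) := by
    intro s i
    funext p
    rcases p with i | x | x <;> rfl
  obtain ⟨s, hs, hsψ⟩ := h.exists_indiscernibleOver (h.mk_finite_lt E₀) (h.mk_finite_lt F) e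
    {⟨2, Formula.relabel r (ψ' (g 0))⟩} (by rintro _ rfl; exact (hψ' _).relabel r)
    (fun k x => f (g k) x) (by
      rintro _ rfl i hi
      rw [Formula.realize_relabel]
      erw [hr (fun k x => f (g k) x) i]
      exact hpair _ _ (hi (show (0 : Fin 2) < 1 by decide)))
  have h01 := hsψ _ rfl (fun k : Fin 2 => (k : ℕ)) (fun _ _ hab => hab)
  rw [Formula.realize_relabel, hr] at h01
  exact hψχ _ _ h01 (hχs _ _ ⟨s, hs, rfl, rfl⟩)

end SmallSaturatedSets

/-! ### Moving small tuples into a saturated e.c. submodel. -/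

section Embedding

variable {L : FirstOrder.Language.{u, u}} {M : Type u} [L.Structure M] {T : L.Theory}
  {κ : Cardinal.{u}}

theorem IsImmersion.nonempty {K K' : Type u} [L.Structure K] [L.Structure K'] [Nonempty K']
    {f : K →[L] K'} (hf : IsImmersion f) : Nonempty K := by
  let φ : L.Formula (Fin 0) := BoundedFormula.ex ⊤
  have := hf 0 φ (.ex .verum) Fin.elim0
    (BoundedFormula.realize_ex.2 ⟨Classical.arbitrary K', BoundedFormula.realize_top.2 trivial⟩)
  obtain ⟨a, -⟩ := BoundedFormula.realize_ex.1 this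
  exact ⟨a⟩

theorem IsMonster.exists_equiv_of_realize_iff (h : IsMonster T κ M) {E : Type u} (hE : #E < κ)
    {a b : E → M} (hab : ∀ φ : L.Formula E, IsPositive φ → (φ.Realize a ↔ φ.Realize b)) :
    ∃ f : M ≃[L] M, ∀ c, f (a c) = b c := by
  refine h.homogeneous E hE a b fun φ hφ => ?_
  let r : (∅ : Set M) ⊕ E → E := Sum.elim (fun c => c.2.elim) id
  have hr : ∀ d : E → M, d ∘ r = Sum.elim (fun c : (∅ : Set M) => (c : M)) d := by
    intro d
    funext p
    rcases p with c | x
    · exact c.2.elim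
    · rfl
  have := hab (Formula.relabel r φ) (hφ.relabel r)
  rwa [Formula.realize_relabel, Formula.realize_relabel, hr, hr] at this

/-- Tuples of size at most `μ` can be moved into a `μ⁺`-saturated e.c. submodel by an automorphism
with prescribed values on a tuple. -/
theorem IsMonster.exists_equiv_mem [Nonempty M] (h : IsMonster T κ M) {N : L.Substructure M}
    (hN : IsEC T N) {μ : Cardinal.{u}} (hμκ : μ < κ)
    (hsat : IsSaturated L N (Order.succ μ)) {E Z : Type u} (hE : #E ≤ μ) (hZ : #Z ≤ μ)
    {e e' : E → M} (he : ∀ φ : L.Formula E, IsPositive φ → (φ.Realize e ↔ φ.Realize e'))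
    (he' : ∀ c, e' c ∈ N) (z : Z → M) :
    ∃ f : M ≃[L] M, (∀ c, f (e c) = e' c) ∧ ∀ x, f (z x) ∈ N := by
  let ι : N →[L] M := N.subtype.toHom
  have hι : IsImmersion ι := hN.2 M h.ec.1 ι
  have : Nonempty N := hι.nonempty
  let eN : E → N := fun c => ⟨e' c, he' c⟩
  obtain ⟨z', hz'⟩ := hsat.exists_realize_of_directed (Order.lt_succ_of_le hE)
    (Order.lt_succ_of_le hZ) eN {φ | IsPositive φ ∧ φ.Realize (Sum.elim e z)}
    (fun φ hφ => hφ.1) ⟨⊤, .verum, Formula.realize_top.2 trivial⟩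
    (fun φ hφ ψ hψ => ⟨φ ⊓ ψ, ⟨hφ.1.inf hψ.1, Formula.realize_inf.2 ⟨hφ.2, hψ.2⟩⟩,
      fun v hv => Formula.realize_inf.1 hv⟩)
    (fun φ hφ => by
      -- The existential formula passes from `e` to `e'` by equality of types, then from `M` down to
      -- `N` by immersion.
      obtain ⟨χ, hχ, hχ'⟩ := hφ.1.exists_projection
      have h1 : χ.Realize e' := (he χ hχ).1 ((hχ' M e).2 ⟨z, hφ.2⟩)
      exact (hχ' N eN).1 (hι.realize_of_realize hχ eN h1))
  obtain ⟨f, hf⟩ := h.exists_equiv_of_realize_iff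
    (h.mk_sum_lt (hE.trans_lt hμκ) (hZ.trans_lt hμκ)) (a := Sum.elim e z)
    (b := Sum.elim e' fun x => (z' x : M)) (fun φ hφ =>
      h.ec.realize_iff_of_imp (fun φ hφ hz => by
        have := hφ.realize_hom ι _ _ (hz' φ ⟨hφ, hz⟩)
        have h2 : φ.Realize (ι ∘ Sum.elim eN z') := by
          rw [Formula.Realize]
          convert this
        convert h2 using 1
        funext p
        rcases p with c | x <;> rfl) hφ)
  refine ⟨f, fun c => hf (Sum.inl c), fun x => ?_⟩
  have := hf (Sum.inr x)
  simp only [Sum.elim_inr] at this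
  rw [this]
  exact (z' x).2

end Embedding

/-! ### Arithmetic of `2^(|C|+λ_T)`. -/

section Cardinals

variable {L : FirstOrder.Language.{u, u}} {M : Type u}

variable (L) in
/-- The size of the saturated sets over `C` that exist by a closing-off argument. -/
noncomputable def closureCard (C : Set M) : Cardinal.{u} := 2 ^ (#C + lambdaT L)

theorem two_power_theoryCard_le_lambdaT : 2 ^ theoryCard L ≤ lambdaT L :=
  (Order.le_succ _).trans (Cardinal.le_beth_ord _)

theorem aleph0_le_lambdaT : ℵ₀ ≤ lambdaT L := Cardinal.aleph0_le_beth _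

theorem aleph0_le_closureCard (C : Set M) : ℵ₀ ≤ closureCard L C :=
  (aleph0_le_lambdaT.trans le_add_self).trans (Cardinal.cantor _).le

theorem mk_le_closureCard (C : Set M) : #C ≤ closureCard L C :=
  le_self_add.trans (Cardinal.cantor _).le

theorem two_power_two_power_le_closureCard (C : Set M) :
    (2 : Cardinal.{u}) ^ ((2 : Cardinal.{u}) ^ theoryCard L) ≤ closureCard L C :=
  Cardinal.power_le_power_left two_ne_zero (two_power_theoryCard_le_lambdaT.trans le_add_self)

/-- The exponent `|C| + λ_T` is infinite and at least `2^|T|`, so it absorbs this factor. This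
permits closing off under operations of arity `2^|T|`. -/
theorem closureCard_power_le (C : Set M) :
    closureCard L C ^ ((2 : Cardinal.{u}) ^ theoryCard L) ≤ closureCard L C := by
  have h1 : (2 : Cardinal.{u}) ^ theoryCard L ≤ #C + lambdaT L :=
    two_power_theoryCard_le_lambdaT.trans le_add_self
  rw [closureCard, ← Cardinal.power_mul]
  refine Cardinal.power_le_power_left two_ne_zero ?_
  exact (mul_le_mul' le_rfl h1).trans_eq
    (Cardinal.mul_eq_self (aleph0_le_lambdaT.trans le_add_self))

end Cardinals

/-! ### Ls-invariance and the partial type `Σ`. -/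

section LsInvariance

variable {L : FirstOrder.Language.{u, u}} {M : Type u} [L.Structure M] {T : L.Theory}
  {κ : Cardinal.{u}}

theorem DistOver.symm {E X : Type*} {n : ℕ} {e : E → M} {a b : X → M}
    (h : DistOver L n e a b) : DistOver L n e b a := by
  obtain ⟨c, rfl, rfl, hc⟩ := h
  refine ⟨fun k => c (n - k), by simp, by simp, fun m hm => ?_⟩
  obtain ⟨s, i, j, hs, hi, hj⟩ := hc (n - (m + 1)) (by omega)
  refine ⟨s, j, i, hs, ?_, hi⟩
  rw [hj]
  congr 1
  omega

/-- The type of a realisation of a maximal consistent set of positive formulas is that set. -/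
theorem IsType.mem_iff {A : Set M} {X : Type*} {q : Set (L.Formula (A ⊕ X))} (hq : IsType q)
    {α : X → M} (hα : Realizes α q) {φ : L.Formula (A ⊕ X)} (hφ : IsPositive φ) :
    φ ∈ q ↔ φ.Realize (Sum.elim (fun c : A => (c : M)) α) := by
  refine ⟨fun h => hα φ h, fun h => ?_⟩
  let p : Set (L.Formula (A ⊕ X)) :=
    {φ | IsPositive φ ∧ φ.Realize (Sum.elim (fun c : A => (c : M)) α)}
  have hp : (∀ φ ∈ p, IsPositive φ) ∧ FinitelySatisfiable p :=
    ⟨fun φ h => h.1, fun Δ hΔ => ⟨α, fun φ h => (hΔ h).2⟩⟩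
  have hqp : q ⊆ p := fun φ h => ⟨hq.prop.1 φ h, hα φ h⟩
  have hle : p ⊆ q := hq.le_of_ge hp hqp
  exact hle ⟨hφ, h⟩

theorem IsMonster.exists_equiv_of_isType (h : IsMonster T κ M) {A : Set M} (hA : #A < κ)
    {X : Type u} (hX : #X < κ) {q : Set (L.Formula (A ⊕ X))} (hq : IsType q) {α β : X → M}
    (hα : Realizes α q) (hβ : Realizes β q) :
    ∃ f : M ≃[L] M, (∀ c ∈ A, f c = c) ∧ ∀ x, f (α x) = β x := by
  obtain ⟨f, hf⟩ := h.exists_equiv_of_realize_iff (h.mk_sum_lt hA hX)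
    (a := Sum.elim (fun c : A => (c : M)) α) (b := Sum.elim (fun c : A => (c : M)) β)
    fun φ hφ => (hq.mem_iff hα hφ).symm.trans (hq.mem_iff hβ hφ)
  exact ⟨f, fun c hc => hf (Sum.inl ⟨c, hc⟩), fun x => hf (Sum.inr x)⟩

/-- The defining property of `Σ`, in terms of distances. -/
def DistPreserving (C N : Set M) {X : Type u} (α : X → M) : Prop :=
  ∀ (k : ℕ) (b b' : Fin k → M), (∀ i, b i ∈ N) → (∀ i, b' i ∈ N) →
    DistLE L C 1 b b' → DistLE L C 2 (Sum.elim α b) (Sum.elim α b')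

theorem isPositive_of_mem_sigmaType {C N : Set M} {hC : C ⊆ N} {X : Type u}
    {ψ : L.Formula (N ⊕ X)} (hψ : ψ ∈ SigmaType L hC X) : IsPositive ψ := by
  obtain ⟨k, b, b', -, φ, hφ, rfl⟩ := hψ
  exact hφ.1.relabel _

theorem sumElim_comp_substVars {C N : Set M} (hC : C ⊆ N) {X : Type u} {k : ℕ}
    (b b' : Fin k → N) (α : X → M) :
    Sum.elim (fun c : N => (c : M)) α ∘ substVars hC X b b' =
      Sum.elim (fun c : C => (c : M))
        (Sum.elim (Sum.elim α fun i => (b i : M)) (Sum.elim α fun i => (b' i : M))) := by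
  funext p
  rcases p with c | (x | i) | (x | i) <;> rfl

theorem IsMonster.realizes_sigmaType_iff [Nonempty M] (h : IsMonster T κ M)
    (hthick : IsThick L M) {C N : Set M} (hC : C ⊆ N) (hCκ : #C < κ) {X : Type u} (hX : #X < κ)
    (α : X → M) : Realizes α (SigmaType L hC X) ↔ DistPreserving (L := L) C N α := by
  constructor
  · intro hα k b b' hb hb' hbb'
    refine (h.isLocal_distOver hthick 2).of_pairType hCκ (X := X ⊕ Fin k) ?_ fun φ hφ => ?_
    · rw [Cardinal.mk_sum, Cardinal.lift_uzero]
      refine Cardinal.add_lt_of_lt h.aleph0_lt.le (by simpa using hX) ?_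
      simpa using Cardinal.natCast_lt_aleph0.trans h.aleph0_lt
    · have := hα _ ⟨k, fun i => ⟨b i, hb i⟩, fun i => ⟨b' i, hb' i⟩, hbb', φ, hφ, rfl⟩
      rwa [Formula.realize_relabel, sumElim_comp_substVars] at this
  · rintro hα _ ⟨k, b, b', hbb', φ, hφ, rfl⟩
    rw [Formula.realize_relabel, sumElim_comp_substVars]
    exact hφ.2 _ _ (hα k _ _ (fun i => (b i).2) (fun i => (b' i).2) hbb')

theorem IsMonster.closureCard_lt (h : IsMonster T κ M) {C : Set M} (hC : #C < κ) :
    closureCard L C < κ :=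
  h.two_power_lt (Cardinal.add_lt_of_lt h.aleph0_lt.le hC (h.beth_small _ h.theory_small))

/-- If `b`, `b'` start a `C`-indiscernible sequence, they start a sequence that is indiscernible over
some set between `C` and `N` realising all small types of finite tuples. -/
theorem IsMonster.exists_realizesFiniteTypes_startsIndiscernible [Nonempty M]
    (h : IsMonster T κ M) {N : L.Substructure M} (hN : IsEC T N) {C : Set M}
    (hC : C ⊆ (N : Set M)) (hCκ : #C < κ)
    (hsat : IsSaturated L N (Order.succ (closureCard L C))) {F : Type u} [Finite F] {b b' : F → M}
    (hb : ∀ i, b i ∈ N) (hb' : ∀ i, b' i ∈ N)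
    (hbb' : StartsIndiscernible L (Subtype.val : C → M) b b') :
    ∃ A : Set M, C ⊆ A ∧ A ⊆ (N : Set M) ∧ #A < κ ∧
      RealizesFiniteTypes L (2 ^ theoryCard L) A ∧
      StartsIndiscernible L (Subtype.val : A → M) b b' := by
  obtain ⟨s, hs, rfl, rfl⟩ := hbb'
  have hμκ := h.closureCard_lt hCκ
  obtain ⟨A, hCA, hA, hrich⟩ := h.ec.exists_realizesFiniteTypes (ν := 2 ^ theoryCard L)
    (Cardinal.cantor _).le (two_power_two_power_le_closureCard C) (closureCard_power_le C) C
    (mk_le_closureCard C)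
  let inc : C → A := Set.inclusion hCA
  let valC : C → M := Subtype.val
  let valA : A → M := Subtype.val
  have hinc : ∀ (n : ℕ) (v : Fin n × F → M), Sum.elim valA v ∘ Sum.map inc id = Sum.elim valC v := by
    intro n v
    rw [Sum.elim_comp_map]
    rfl
  -- Prescribing all formulas over `C` true on increasing tuples of `s` forces `s' 0, s' 1` to have
  -- the type of `s 0, s 1` over `C`.
  obtain ⟨s', hs', hΦ⟩ := h.exists_indiscernibleOver (hA.trans_lt hμκ) (h.mk_finite_lt F) valA
    {p | ∃ (n : ℕ) (χ : L.Formula (C ⊕ (Fin n × F))), IsPositive χ ∧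
      (∀ i : Fin n → ℕ, StrictMono i → χ.Realize (Sum.elim valC fun q => s (i q.1) q.2)) ∧
        p = ⟨n, Formula.relabel (Sum.map inc id) χ⟩}
    (by rintro _ ⟨n, χ, hχ, -, rfl⟩; exact hχ.relabel _) s (by
      rintro _ ⟨n, χ, hχ, hχs, rfl⟩ i hi
      rw [Formula.realize_relabel, hinc]
      exact hχs i hi)
  have h01 : StrictMono fun k : Fin 2 => (k : ℕ) := fun _ _ hab => hab
  let r : C ⊕ (F ⊕ F) → C ⊕ (Fin 2 × F) :=
    Sum.map id (Sum.elim (fun x => (0, x)) (fun x => (1, x)))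
  have hr : ∀ (s : ℕ → F → M) , Sum.elim valC (fun q : Fin 2 × F => s q.1 q.2) ∘ r =
      Sum.elim valC (Sum.elim (s 0) (s 1)) := by
    intro s
    funext p
    rcases p with c | x | x <;> rfl
  have htype : ∀ φ : L.Formula (C ⊕ (F ⊕ F)), IsPositive φ →
      (φ.Realize (Sum.elim valC (Sum.elim (s' 0) (s' 1))) ↔
        φ.Realize (Sum.elim valC (Sum.elim (s 0) (s 1)))) := by
    intro φ hφ
    refine (h.ec.realize_iff_of_imp (fun φ hφ hφs => ?_) hφ).symm
    have := hΦ _ ⟨2, Formula.relabel r φ, hφ.relabel r, fun i hi => ?_, rfl⟩ _ h01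
    · rwa [Formula.realize_relabel, hinc, Formula.realize_relabel, hr] at this
    · rw [hs 2 i _ hi h01 _ (hφ.relabel r), Formula.realize_relabel]
      erw [hr]
      exact hφs
  obtain ⟨f, hf, hfA⟩ := h.exists_equiv_mem hN hμκ hsat
    (by
      rw [Cardinal.mk_sum, Cardinal.lift_id, Cardinal.lift_id]
      exact Cardinal.add_le_of_le (aleph0_le_closureCard C) (mk_le_closureCard C)
        ((Cardinal.lt_aleph0_of_finite _).le.trans (aleph0_le_closureCard C)))
    hA htype (by
      rintro (c | i | i)
      · exact hC c.2
      · exact hb i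
      · exact hb' i) valA
  have hfC : ∀ c ∈ C, f c = c := fun c hc => hf (Sum.inl ⟨c, hc⟩)
  have hf0 : (fun x => f (s' 0 x)) = s 0 := funext fun x => hf (Sum.inr (Sum.inl x))
  have hf1 : (fun x => f (s' 1 x)) = s 1 := funext fun x => hf (Sum.inr (Sum.inr x))
  refine ⟨f '' A, fun c hc => ⟨c, hCA hc, hfC c hc⟩, ?_, Cardinal.mk_image_le.trans_lt
    (hA.trans_lt hμκ), hrich.image f, fun k x => f (s' k x), ?_, hf0, hf1⟩
  · rintro _ ⟨a, ha, rfl⟩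
    exact hfA ⟨a, ha⟩
  · choose g hg using fun a : f '' A => a.2
    have hpull := (hs'.map f).pullback (fun a => (⟨g a, (hg a).1⟩ : A)) id
    have hval : (fun c => f (valA c)) ∘ (fun a => (⟨g a, (hg a).1⟩ : A)) =
        (Subtype.val : f '' A → M) := funext fun a => (hg a).2
    rwa [hval] at hpull

/-- Invariance is applied to the infinite tuples `bA` and `b'A`: an unspecified finite distance over
`C` then yields equality of types over `A`, and the richness of `A` turns this into the bound two.
-/
theorem IsMonster.distPreserving_of_lsInvariant [Nonempty M] (h : IsMonster T κ M)
    (hthick : IsThick L M) {N : L.Substructure M} (hN : IsEC T N) {C : Set M}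
    (hC : C ⊆ (N : Set M)) (hCκ : #C < κ)
    (hsat : IsSaturated L N (Order.succ (closureCard L C))) {X : Type u} (hX : #X < κ)
    {q : Set (L.Formula ((N : Set M) ⊕ X))} (hq : LsInvariant C q) {α : X → M}
    (hα : Realizes α q) : DistPreserving (L := L) C (N : Set M) α := by
  have key : ∀ (k : ℕ) (b b' : Fin k → M), (∀ i, b i ∈ N) → (∀ i, b' i ∈ N) →
      StartsIndiscernible L (Subtype.val : C → M) b b' →
        DistOver L 2 (Subtype.val : C → M) (Sum.elim α b) (Sum.elim α b') := by
    rintro k b b' hb hb' ⟨s, hs, rfl, rfl⟩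
    let F : Type u := ULift.{u} (Fin k)
    obtain ⟨A, hCA, hAN, hAκ, hrich, hstart⟩ :=
      h.exists_realizesFiniteTypes_startsIndiscernible hN hC hCκ hsat (F := F)
        (b := s 0 ∘ ULift.down) (b' := s 1 ∘ ULift.down) (fun i => hb _) (fun i => hb' _)
        ⟨_, hs.pullback id ULift.down, rfl, rfl⟩
    let valA : A → M := Subtype.val
    have hLs := hq α hα (F ⊕ A) (Sum.elim (s 0 ∘ ULift.down) valA)
      (Sum.elim (s 1 ∘ ULift.down) valA)
      (by rintro (i | a); exacts [hb _, hAN a.2]) (by rintro (i | a); exacts [hb' _, hAN a.2])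
      ⟨1, (hstart.distOver.adjoin_params id).pullback (Set.inclusion hCA) id⟩
    obtain ⟨n, hn⟩ := hLs
    have hsame : SameType L A (Sum.elim α (s 0 ∘ ULift.down) : X ⊕ F → M)
        (Sum.elim α (s 1 ∘ ULift.down)) := by
      intro φ hφ
      let r : A ⊕ (X ⊕ F) → C ⊕ (X ⊕ (F ⊕ A)) :=
        Sum.elim (fun a => Sum.inr (Sum.inr (Sum.inr a)))
          (Sum.elim (fun x => Sum.inr (Sum.inl x)) (fun i => Sum.inr (Sum.inr (Sum.inl i))))
      have hr : ∀ d : F → M, Sum.elim (Subtype.val : C → M) (Sum.elim α (Sum.elim d valA)) ∘ r =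
          Sum.elim valA (Sum.elim α d) := by
        intro d
        funext p
        rcases p with a | x | i <;> rfl
      have := (distLE_iff_distOver.1 hn).realize_iff (hφ.relabel r)
      rwa [Formula.realize_relabel, Formula.realize_relabel, hr, hr] at this
    have h2 := (h.distOver_two_of_sameType hthick hAκ hrich
      (h.mk_sum_lt hX (h.mk_finite_lt F)) hsame).pullback (Set.inclusion hCA)
      (Sum.map id ULift.up : X ⊕ Fin k → X ⊕ F)
    rwa [Sum.elim_comp_map, Sum.elim_comp_map] at h2
  intro k b b' hb hb' hbb'
  rcases distOver_one_iff.1 (distLE_iff_distOver.1 hbb') with h1 | h1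
  · exact key k b b' hb hb' h1
  · exact (key k b' b hb' hb h1).symm

/-- Distances between finite tuples of `N` are witnessed in `N`. -/
theorem IsMonster.exists_chain_mem [Nonempty M] (h : IsMonster T κ M) {N : L.Substructure M}
    (hN : IsEC T N) {C : Set M} (hC : C ⊆ (N : Set M)) (hCκ : #C < κ)
    (hsat : IsSaturated L N (Order.succ (closureCard L C))) {k n : ℕ} {b b' : Fin k → M}
    (hb : ∀ i, b i ∈ N) (hb' : ∀ i, b' i ∈ N)
    (hbb' : DistOver L n (Subtype.val : C → M) b b') :
    ∃ c : ℕ → Fin k → M, (∀ m i, c m i ∈ N) ∧ c 0 = b ∧ c n = b' ∧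
      ∀ m < n, DistOver L 1 (Subtype.val : C → M) (c m) (c (m + 1)) := by
  obtain ⟨c, rfl, rfl, hc⟩ := hbb'
  let F : Type u := ULift.{u} (Fin k)
  let e : C ⊕ (F ⊕ F) → M := Sum.elim Subtype.val
    (Sum.elim (fun i => c 0 i.down) (fun i => c n i.down))
  have hμ0 := aleph0_le_closureCard (L := L) C
  -- The chain is moved into `N` as one tuple, with `C` and both endpoints fixed; the witnessing
  -- indiscernible sequences need not lie in `N`.
  obtain ⟨f, hf, hfN⟩ := h.exists_equiv_mem hN (h.closureCard_lt hCκ) hsat (e := e) (e' := e)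
    (Z := ULift.{u} ℕ × F)
    (by
      rw [Cardinal.mk_sum, Cardinal.lift_id, Cardinal.lift_id]
      exact Cardinal.add_le_of_le hμ0 (mk_le_closureCard C)
        ((Cardinal.lt_aleph0_of_finite _).le.trans hμ0))
    (Cardinal.mk_le_aleph0.trans hμ0) (fun _ _ => Iff.rfl) (by
      rintro (c | i | i)
      · exact hC c.2
      · exact hb _
      · exact hb' _) (fun q => c q.1.down q.2.down)
  have hfC : (fun c : C => f c) = Subtype.val := funext fun c => hf (Sum.inl c)
  refine ⟨fun m i => f (c m i), fun m i => hfN (⟨m⟩, ⟨i⟩),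
    funext fun i => hf (Sum.inr (Sum.inl ⟨i⟩)), funext fun i => hf (Sum.inr (Sum.inr ⟨i⟩)),
    fun m hm => ?_⟩
  have h1 : DistOver L 1 (Subtype.val : C → M) (c m) (c (m + 1)) := by
    refine ⟨fun l => c (m + l), rfl, rfl, fun l hl => ?_⟩
    obtain rfl : l = 0 := by omega
    exact hc m hm
  have := h1.map f
  rwa [hfC] at this

theorem IsMonster.lsInvariant_of_distPreserving [Nonempty M] (h : IsMonster T κ M)
    (hthick : IsThick L M) {N : L.Substructure M} (hN : IsEC T N) (hNκ : #(N : Set M) < κ)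
    {C : Set M} (hC : C ⊆ (N : Set M)) (hCκ : #C < κ)
    (hsat : IsSaturated L N (Order.succ (closureCard L C))) {X : Type u} (hX : #X < κ)
    {q : Set (L.Formula ((N : Set M) ⊕ X))} (hq : IsType q) {α : X → M} (hα : Realizes α q)
    (hαN : DistPreserving (L := L) C (N : Set M) α) : LsInvariant C q := by
  classical
  let valC : C → M := Subtype.val
  have hfin : ∀ (n k : ℕ) (b b' : Fin k → M), (∀ i, b i ∈ N) → (∀ i, b' i ∈ N) →
      DistOver L n valC b b' →
        DistOver L (2 * n) valC (Sum.elim α b) (Sum.elim α b') := by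
    intro n k b b' hb hb' hbb'
    obtain ⟨c, hcN, rfl, rfl, hc⟩ := h.exists_chain_mem hN hC hCκ hsat hb hb' hbb'
    have : ∀ m ≤ n, DistOver L (2 * m) valC (Sum.elim α (c 0)) (Sum.elim α (c m)) := by
      intro m hm
      induction m with
      | zero => exact distOver_zero.2 rfl
      | succ m ih =>
        exact (ih (by omega)).trans (hαN k _ _ (hcN m) (hcN (m + 1)) (hc m (by omega)))
    exact this n le_rfl
  have hsmall : ∀ (n : ℕ) (J : Type u), #J < κ → ∀ b b' : J → M, (∀ i, b i ∈ N) →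
      (∀ i, b' i ∈ N) → DistOver L n valC b b' →
        DistOver L (2 * n) valC (Sum.elim α b) (Sum.elim α b') := by
    intro n J hJ b b' hb hb' hbb'
    refine (h.isLocal_distOver hthick (2 * n)).of_finset hCκ (h.mk_sum_lt hX hJ) fun E₀ F => ?_
    let G : Finset J := F.biUnion (Sum.elim (fun _ => ∅) fun j => {j})
    let e : G ≃ Fin G.card := G.equivFin
    let r : F → X ⊕ Fin G.card := fun p => match p with
      | ⟨Sum.inl x, _⟩ => Sum.inl x
      | ⟨Sum.inr j, hj⟩ => Sum.inr (e ⟨j, Finset.mem_biUnion.2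
          ⟨_, hj, Finset.mem_singleton_self _⟩⟩)
    have hr : ∀ d : J → M, (Sum.elim α fun i => d (e.symm i)) ∘ r =
        fun p : F => Sum.elim α d p := by
      intro d
      funext p
      rcases p with ⟨x | j, hp⟩
      · rfl
      · simp [r]
    have := (hfin n G.card (fun i => b (e.symm i)) (fun i => b' (e.symm i)) (fun i => hb _)
      (fun i => hb' _) (hbb'.pullback id fun i => (e.symm i : J))).pullback
      (Subtype.val : E₀ → C) r
    rw [hr, hr] at this
    exact this
  intro β hβ J b b' hb hb' hbb'
  obtain ⟨n, hn⟩ := hbb'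
  obtain ⟨f, hfN, hfα⟩ := h.exists_equiv_of_isType hNκ hX hq hα hβ
  -- `J` may be large, but there are few pairs of elements of `N`: one index per pair is kept, and
  -- the full tuples are recovered by repeating coordinates.
  let π : J → ↥(N : Set M) × ↥(N : Set M) := fun j => (⟨b j, hb j⟩, ⟨b' j, hb' j⟩)
  choose sec hsec using fun p : Set.range π => p.2
  have hb1 : ∀ j, b (sec ⟨π j, j, rfl⟩) = b j := fun j =>
    congrArg (fun p => ((p.1 : (N : Set M)) : M)) (hsec ⟨π j, j, rfl⟩)
  have hb2 : ∀ j, b' (sec ⟨π j, j, rfl⟩) = b' j := fun j =>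
    congrArg (fun p => ((p.2 : (N : Set M)) : M)) (hsec ⟨π j, j, rfl⟩)
  have h1 := hsmall n (Set.range π)
    ((Cardinal.mk_set_le _).trans_lt (h.mk_prod_lt hNκ hNκ)) (b ∘ sec) (b' ∘ sec)
    (fun i => hb _) (fun i => hb' _) ((distLE_iff_distOver.1 hn).pullback id sec)
  have h2 := (h1.map f).pullback id
    (Sum.map id (fun j => ⟨π j, j, rfl⟩) : X ⊕ J → X ⊕ Set.range π)
  refine ⟨2 * n, ?_⟩
  rw [distLE_iff_distOver]
  convert h2 using 1
  · exact funext fun c => (hfN _ (hC c.2)).symm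
  · funext p
    rcases p with x | j
    · exact (hfα x).symm
    · simpa [hb1] using (hfN _ (hb j)).symm
  · funext p
    rcases p with x | j
    · exact (hfα x).symm
    · simpa [hb2] using (hfN _ (hb' j)).symm

end LsInvariance

end PositiveLogic

theorem mainTheorem9 {L : FirstOrder.Language.{u, u}} (T : L.Theory) (hT : PositiveLogic.IsHInductive T)
    (𝔐 : Type u) [L.Structure 𝔐] [Nonempty 𝔐] (κ : Cardinal.{u})
    (h𝔐 : PositiveLogic.IsMonster T κ 𝔐) (hthick : PositiveLogic.IsThick L 𝔐)
    (N : L.Substructure 𝔐) (hN : PositiveLogic.IsEC T N) (hNκ : #N < κ)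
    (C : Set 𝔐) (hC : C ⊆ (N : Set 𝔐))
    (hsat : PositiveLogic.IsSaturated L N
      (Order.succ ((2 : Cardinal.{u}) ^ (#C + PositiveLogic.lambdaT L))))
    (X : Type u) (hX : #X < κ) :
    -- `Σ(x)` is a set of positive formulas over `N`,
    (∀ ψ ∈ PositiveLogic.SigmaType L hC X, PositiveLogic.IsPositive ψ) ∧
    -- it expresses the stated conditions,
    (∀ α : X → 𝔐, PositiveLogic.Realizes α (PositiveLogic.SigmaType L hC X) ↔
      ∀ (k : ℕ) (b b' : Fin k → 𝔐), (∀ i, b i ∈ N) → (∀ i, b' i ∈ N) →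
        PositiveLogic.DistLE L C 1 b b' →
          PositiveLogic.DistLE L C 2 (Sum.elim α b) (Sum.elim α b')) ∧
    -- and a type over `N` is `C`-Ls-invariant iff its realisations (all, equivalently some)
    -- satisfy `Σ`.
    (∀ q : Set (L.Formula ((N : Set 𝔐) ⊕ X)), PositiveLogic.IsType q →
      (PositiveLogic.LsInvariant C q ↔
        ∀ α : X → 𝔐, PositiveLogic.Realizes α q →
          PositiveLogic.Realizes α (PositiveLogic.SigmaType L hC X)) ∧
      (PositiveLogic.LsInvariant C q ↔
        ∃ α : X → 𝔐, PositiveLogic.Realizes α q ∧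
          PositiveLogic.Realizes α (PositiveLogic.SigmaType L hC X))) := by

  have hCκ : #C < κ := (Cardinal.mk_le_mk_of_subset hC).trans_lt hNκ
  have hiff := h𝔐.realizes_sigmaType_iff hthick hC hCκ hX
  refine ⟨fun ψ => PositiveLogic.isPositive_of_mem_sigmaType, hiff, fun q hq => ?_⟩
  have hto : PositiveLogic.LsInvariant C q → ∀ α : X → 𝔐, PositiveLogic.Realizes α q →
      PositiveLogic.Realizes α (PositiveLogic.SigmaType L hC X) := fun hinv α hα =>
    (hiff α).2 (h𝔐.distPreserving_of_lsInvariant hthick hN hC hCκ hsat hX hinv hα)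
  have hfrom : ∀ α : X → 𝔐, PositiveLogic.Realizes α q →
      PositiveLogic.Realizes α (PositiveLogic.SigmaType L hC X) →
        PositiveLogic.LsInvariant C q := fun α hα hαS =>
    h𝔐.lsInvariant_of_distPreserving hthick hN hNκ hC hCκ hsat hX hq hα ((hiff α).1 hαS)
  -- A realisation exists, so the condition on all realisations is not vacuous.
  obtain ⟨α, hα⟩ := h𝔐.saturated _ hNκ X hX q hq.prop.1 hq.prop.2
  exact ⟨⟨hto, fun hall => hfrom α hα (hall α hα)⟩,
    ⟨fun hinv => ⟨α, hα, hto hinv α hα⟩, fun ⟨β, hβ, hβS⟩ => hfrom β hβ hβS⟩⟩
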